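/- \textbf{Theorem 1.} Cutting Planes and Facelike Stabbing Planes are polynomially equivalent. In detail: Let $F$ be a finite system of linear inequalities $ax\ge b$ with $a\in\mathbb Z^n$, $b\in\mathbb Z$. A \emph{Cutting Planes} (CP) refutation of $F$ is a sequence of integer linear inequalities that ends in $0\ge 1$, in which each inequality belongs to $F$ or is obtained from earlier ones by one of two rules: \emph{linear combination} (from $ax\ge b$ and $cx\ge d$ deduce $(\alpha a+\beta c)x\ge \alpha b+\beta d$, for integers $\alpha,\beta\ge 0$) and \emph{division} (from $ax\ge b$ deduce $(a/d)x\ge\lceil b/d\rceil$, where $d\ge 1$ is an integer that divides all entries of $a$). Its size is the number of its inequalities. A \emph{Stabbing Planes} (SP) refutation of $F$ is a finite binary tree. Each internal node has a query $(ax\le b-1,\ ax\ge b)$ with $a\in\mathbb Z^n$, $b\in\mathbb Z$; its two outgoing edges are labelled by these two inequalities. Each leaf is labelled by a linear combination, with non-negative rational multipliers, of the inequalities of $F$ and of those on the path from the root to the leaf, that yields $0\ge 1$. Its size is the bit-length of the whole tree, with all labels. To each node corresponds the polyhedron $P\subseteq\mathbb R^n$ defined by $F$ and the inequalities on the path from the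 root to the node. A \emph{face} of $P$ is a set $P\cap\{x: cx=e\}$ with $c\in\mathbb R^n$ and $e=\max\{cx:x\in P\}$ (where the maximum exists). The query is \emph{facelike} if at least one of $P\cap\{ax\le b-1\}$ and $P\cap\{ax\ge b\}$ is empty or a face of $P$. The refutation is \emph{facelike} if all its queries are. Let $|F|$ be the bit-length of $F$. There is a polynomial $p$ such that for all $n$ and all $F$ as above: \begin{enumerate} \item if $F$ has a CP refutation of size $s$, then $F$ has a facelike SP refutation of size at most $p(|F|+s)$, and one with at most $p(n+s)$ queries; \item if $F$ has a facelike SP refutation of size $s$, then $F$ has a CP refutation of size at most $p(|F|+s)$; if $F$ has a facelike SP refutation with $s$ queries, then $F$ has a CP refutation of size at most $p(n+s)$. \end{enumerate} -/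

import Mathlib

/-- An integer linear inequality `coeff · x ≥ rhs` in `n` variables. -/
structure LinIneq (n : ℕ) where
  coeff : Fin n → ℤ
  rhs : ℤ

namespace LinIneq

variable {n : ℕ}

/-- The half-space of real points that satisfy the inequality. -/
def halfspace (I : LinIneq n) : Set (Fin n → ℝ) :=
  {x | (I.rhs : ℝ) ≤ ∑ j, (I.coeff j : ℝ) * x j}

/-- The integer negation of `a x ≥ b`, namely `a x ≤ b - 1`, written as `(-a) x ≥ 1 - b`. -/
def integerNegation (I : LinIneq n) : LinIneq n :=
  ⟨fun j => -I.coeff j, 1 - I.rhs⟩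

/-- The combination `α I + β J`. -/
def linComb (α β : ℕ) (I J : LinIneq n) : LinIneq n :=
  ⟨fun j => (α : ℤ) * I.coeff j + (β : ℤ) * J.coeff j, (α : ℤ) * I.rhs + (β : ℤ) * J.rhs⟩

/-- The inequality `(a / d) x ≥ ⌈b / d⌉`; used only where `d > 0` divides every entry of `a`. -/
def divide (d : ℕ) (I : LinIneq n) : LinIneq n :=
  ⟨fun j => I.coeff j / (d : ℤ), ⌈(I.rhs : ℚ) / (d : ℚ)⌉⟩

/-- The false inequality `0 ≥ 1`. -/
def falsum (n : ℕ) : LinIneq n := ⟨fun _ => 0, 1⟩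

end LinIneq

/-- The bit-length of an integer: its binary digits and a sign bit. -/
def intBits (z : ℤ) : ℕ := z.natAbs.size + 1

/-- The bit-length of an inequality: that of all its coefficients and of its right-hand side. -/
def LinIneq.bits {n : ℕ} (I : LinIneq n) : ℕ := (∑ j, intBits (I.coeff j)) + intBits I.rhs

/-- A finite system of integer linear inequalities in `n` variables. -/
abbrev LinSystem (n : ℕ) := List (LinIneq n)

namespace LinSystem

variable {n : ℕ}

/-- The set of real solutions of a system. -/
def polyhedron (F : LinSystem n) : Set (Fin n → ℝ) := {x | ∀ I ∈ F, x ∈ I.halfspace}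

/-- The bit-length of a system. -/
def bits (F : LinSystem n) : ℕ := (F.map LinIneq.bits).sum

end LinSystem

/-! ### Cutting Planes -/

/-- `CPStep F prev I`: the inequality `I` belongs to `F` or follows from inequalities in `prev` by
one application of a rule of Cutting Planes. -/
inductive CPStep {n : ℕ} (F : LinSystem n) (prev : List (LinIneq n)) : LinIneq n → Prop
  | hyp (I : LinIneq n) (hI : I ∈ F) : CPStep F prev I
  | linComb (I J : LinIneq n) (hI : I ∈ prev) (hJ : J ∈ prev) (α β : ℕ) :
      CPStep F prev (LinIneq.linComb α β I J)
  | division (I : LinIneq n) (hI : I ∈ prev) (d : ℕ) (hd : 0 < d)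
      (hdvd : ∀ j, (d : ℤ) ∣ I.coeff j) : CPStep F prev (LinIneq.divide d I)

/-- A Cutting Planes proof of the inequality `goal` from the system `F`. -/
structure CPProof {n : ℕ} (F : LinSystem n) (goal : LinIneq n) where
  lines : List (LinIneq n)
  valid : ∀ (i : ℕ) (hi : i < lines.length), CPStep F (lines.take i) lines[i]
  ends : lines.getLast? = some goal

/-- A Cutting Planes refutation of `F` is a proof of `0 ≥ 1` from `F`. -/
abbrev CPRefutation {n : ℕ} (F : LinSystem n) := CPProof F (LinIneq.falsum n)

/-- The size of a Cutting Planes proof is its number of lines. -/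
def CPProof.size {n : ℕ} {F : LinSystem n} {goal : LinIneq n} (π : CPProof F goal) : ℕ :=
  π.lines.length

/-! ### Stabbing Planes -/

/-- Stabbing Planes refutations of `F`. In a subtree, `F` consists of the initial inequalities
together with the labels of the path from the root. A node carries a query
`(a x ≤ b - 1, a x ≥ b)`, given by its second inequality `q`; a leaf carries the multipliers of a
non-negative linear combination of the inequalities of `F` that yields `0 ≥ 1`. -/
inductive SPRefutation {n : ℕ} : LinSystem n → Type
  | leaf (F : LinSystem n) (w : Fin F.length → ℚ)
      (nonneg : ∀ i, 0 ≤ w i)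
      (coeff_eq : ∀ j, ∑ i, w i * ((F.get i).coeff j : ℚ) = 0)
      (rhs_eq : ∑ i, w i * ((F.get i).rhs : ℚ) = 1) : SPRefutation F
  | node (F : LinSystem n) (q : LinIneq n)
      (left : SPRefutation (q.integerNegation :: F))
      (right : SPRefutation (q :: F)) : SPRefutation F

/-- `G` is a face of `P`: the intersection of `P` with a supporting hyperplane `c x = e`, where
`e = max {c x : x ∈ P}`. -/
def IsFaceOf {n : ℕ} (P G : Set (Fin n → ℝ)) : Prop :=
  ∃ (c : Fin n → ℝ) (e : ℝ), IsGreatest ((fun x => ∑ j, c j * x j) '' P) e ∧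
    G = P ∩ {x | ∑ j, c j * x j = e}

/-- The query `(a x ≤ b - 1, a x ≥ b)`, given by `q = (a x ≥ b)`, is facelike at `P`. -/
def FacelikeQuery {n : ℕ} (P : Set (Fin n → ℝ)) (q : LinIneq n) : Prop :=
  (P ∩ q.integerNegation.halfspace = ∅ ∨ IsFaceOf P (P ∩ q.integerNegation.halfspace)) ∨
  (P ∩ q.halfspace = ∅ ∨ IsFaceOf P (P ∩ q.halfspace))

namespace SPRefutation

variable {n : ℕ}

/-- Every query of the refutation is facelike at the polyhedron of its node. -/
def Facelike : {F : LinSystem n} → SPRefutation F → Prop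
  | _, leaf _ _ _ _ _ => True
  | _, node F q l r => FacelikeQuery F.polyhedron q ∧ l.Facelike ∧ r.Facelike

/-- The number of queries. -/
def queries : {F : LinSystem n} → SPRefutation F → ℕ
  | _, leaf _ _ _ _ _ => 0
  | _, node _ _ l r => l.queries + r.queries + 1

/-- The size of a Stabbing Planes refutation is the bit-length of the whole tree: one bit per node
for its kind, the labels of all edges, and the multipliers at all leaves. -/
def size : {F : LinSystem n} → SPRefutation F → ℕ
  | _, leaf _ w _ _ _ => 1 + ∑ i, (intBits (w i).num + intBits ((w i).den : ℤ))
  | _, node _ q l r => 1 + q.integerNegation.bits + q.bits + l.size + r.size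

end SPRefutation

/-! ### Polynomial equivalence -/

/-- A refutation system with a complexity measure: `S F s` says that the system `F` has a
refutation of measure `s`. -/
abbrev MeasuredSystem := ∀ ⦃n : ℕ⦄, LinSystem n → ℕ → Prop

/-- Cutting Planes, measured by size (number of lines). -/
def CPSystem : MeasuredSystem := fun _ F s => ∃ π : CPRefutation F, π.size = s

/-- Facelike Stabbing Planes, measured by size (bit-length). -/
def FacelikeSP : MeasuredSystem := fun _ F s =>
  ∃ T : SPRefutation F, T.Facelike ∧ T.size = s

/-- Facelike Stabbing Planes, measured by the number of queries. -/
def FacelikeSPQueries : MeasuredSystem := fun _ F s =>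
  ∃ T : SPRefutation F, T.Facelike ∧ T.queries = s

/-- `A` polynomially simulates `B`: a refutation of `F` in `B` of measure `s` gives one in `A` whose
measure is at most a fixed polynomial in `s` and the measure `m F` of the refuted system. -/
def PolySimulates (m : ∀ ⦃n : ℕ⦄, LinSystem n → ℕ) (A B : MeasuredSystem) : Prop :=
  ∃ p : Polynomial ℕ, ∀ (n : ℕ) (F : LinSystem n) (s : ℕ),
    B F s → ∃ t ≤ p.eval (m F + s), A F t

/-- Polynomial equivalence, with polynomials in the measure of the proof and `m F`. -/
def PolyEquivalent (m : ∀ ⦃n : ℕ⦄, LinSystem n → ℕ) (A B : MeasuredSystem) : Prop :=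
  PolySimulates m A B ∧ PolySimulates m B A

/-! Both directions use rounding cuts: integer inequalities whose right-hand side is at most the
rounded-up bound given by a conic combination of available inequalities.

From facelike Stabbing Planes to Cutting Planes (`CutRefutable.of_facelike`), a facelike query at
`P` is replaced by one cut. If a side is empty, Farkas' lemma bounds the query with positive slack,
and rounding yields the other side. If the side `ax ≥ b` is a face, then either `P` lies in it, so
that the other side is empty, or `ax ≤ b` on `P` and the face is `ax = b`
(`subset_halfspace_or_of_isFaceOf`). In the latter case the refutation below the face is lifted to
`P` (`lift_face`): since `-ax ≥ -b` is valid, subtracting a large integer multiple of `ax ≥ b` from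
each cut makes it derivable without the query, and the final `0 ≥ 1` becomes `-Kax ≥ 1 - Kb`, which
rounds to `ax ≤ b - 1`. The refutation of the other side then takes over. Thus a tree with `k`
queries gives `k` cuts. By Carathéodory a cut combines at most `n + 1` inequalities, hence costs
`O(n)` lines; the size of `K` is irrelevant, since only lines are counted.

From Cutting Planes to Stabbing Planes (`exists_facelike_of_CPValid`), only division needs a query,
namely one whose first side is empty. The coefficients of the given lines may be enormous, so the
query keeps only the fractional parts of the multipliers (`Implied.exists_small_cut`); the integral
parts are conic consequences already available. Query entries then grow by at most a polynomial
factor per division. Leaves are kept short by Carathéodory and Cramer's rule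
(`Implied.exists_small_leaf`). -/

/-! ### Conic combinations and Farkas' lemma over an ordered field -/

section OrderedField

variable {𝕜 : Type*} [Field 𝕜] [LinearOrder 𝕜] [IsStrictOrderedRing 𝕜]

/-- Carathéodory's theorem for cones: a non-negative combination can be rewritten so that the
vectors used are linearly independent. -/
theorem exists_nonneg_sum_eq_linearIndepOn {ι V : Type*} [Fintype ι] [AddCommGroup V] [Module 𝕜 V]
    (v : ι → V) (w : ι → 𝕜) (hw : ∀ i, 0 ≤ w i) :
    ∃ u : ι → 𝕜, (∀ i, 0 ≤ u i) ∧ ∑ i, u i • v i = ∑ i, w i • v i ∧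
      LinearIndepOn 𝕜 v {i | u i ≠ 0} := by
  classical
  induction hk : (Finset.univ.filter fun i => w i ≠ 0).card using Nat.strong_induction_on
    generalizing w with
  | _ k ih =>
    by_cases hli : LinearIndepOn 𝕜 v {i | w i ≠ 0}
    · exact ⟨w, hw, rfl, hli⟩
    obtain ⟨l, hl, hl0, hpos⟩ : ∃ l : ι → 𝕜, (∀ i, w i = 0 → l i = 0) ∧ ∑ i, l i • v i = 0 ∧
        ∃ i, 0 < l i := by
      rw [linearIndepOn_iff] at hli
      push Not at hli
      obtain ⟨l, hl, hl0, hne⟩ := hli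
      have hsupp : ∀ i, w i = 0 → l i = 0 := by
        intro i hi
        by_contra hli
        exact (Finsupp.mem_supported _ _).1 hl (Finsupp.mem_support_iff.2 hli) hi
      have hsum : ∑ i, l i • v i = 0 := by
        rw [← hl0, Finsupp.linearCombination_apply, Finsupp.sum_fintype _ _ (by simp)]
      obtain ⟨i, hi⟩ := Finsupp.ne_iff.1 hne
      rcases lt_or_gt_of_ne hi with h | h
      · refine ⟨fun i => -l i, fun i hi => by simp [hsupp i hi], by simp [hsum], i, ?_⟩
        simpa using h
      · exact ⟨l, hsupp, hsum, i, h⟩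
    -- Ratio test: `w i₀ / l i₀` is the largest multiple of the dependency that can be subtracted
    -- while keeping all weights non-negative, and it kills the weight at `i₀`.
    obtain ⟨i₀, hi₀, hmin⟩ := Finset.exists_min_image (Finset.univ.filter fun i => 0 < l i)
      (fun i => w i / l i) (by obtain ⟨i, hi⟩ := hpos; exact ⟨i, by simpa using hi⟩)
    simp only [Finset.mem_filter, Finset.mem_univ, true_and] at hi₀ hmin
    have ht : 0 ≤ w i₀ / l i₀ := div_nonneg (hw _) hi₀.le
    have hw₀ : w i₀ ≠ 0 := fun h => hi₀.ne' (hl _ h)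
    have hz : w i₀ - w i₀ / l i₀ * l i₀ = 0 := by
      rw [div_mul_cancel₀ _ hi₀.ne', sub_self]
    have hcard : (Finset.univ.filter fun i => w i - w i₀ / l i₀ * l i ≠ 0).card < k := by
      rw [← hk]
      refine Finset.card_lt_card (Finset.ssubset_iff_of_subset ?_ |>.2 ⟨i₀, by simpa using hw₀, ?_⟩)
      · intro i
        simp only [Finset.mem_filter, Finset.mem_univ, true_and]
        intro h hi
        exact h (by simp [hi, hl i hi])
      · simpa using hz
    have hnonneg : ∀ i, 0 ≤ w i - w i₀ / l i₀ * l i := by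
      intro i
      rcases le_or_gt (l i) 0 with h | h
      · have := mul_nonpos_of_nonneg_of_nonpos ht h
        have := hw i
        linarith
      · have := hmin i h
        rw [le_div_iff₀ h] at this
        linarith
    obtain ⟨u, hu, hsum, hind⟩ := ih _ hcard _ hnonneg rfl
    refine ⟨u, hu, ?_, hind⟩
    rw [hsum]
    simp only [sub_smul, mul_smul, Finset.sum_sub_distrib, ← Finset.smul_sum, hl0, smul_zero,
      sub_zero]

/-- Farkas' lemma: a functional is a non-negative combination of finitely many given ones, or some
vector separates it from them. -/
theorem farkas_functional {W : Type*} [AddCommGroup W] [Module 𝕜 W] {m : ℕ}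
    (A : Fin m → W →ₗ[𝕜] 𝕜) (b : W →ₗ[𝕜] 𝕜) :
    (∃ u : Fin m → 𝕜, (∀ i, 0 ≤ u i) ∧ b = ∑ i, u i • A i) ∨
      ∃ x, (∀ i, A i x ≤ 0) ∧ 0 < b x := by
  induction m generalizing b with
  | zero =>
    by_cases hb : b = 0
    · exact Or.inl ⟨Fin.elim0, fun i => i.elim0, by simp [hb]⟩
    · right
      obtain ⟨x, hx⟩ : ∃ x, b x ≠ 0 := by
        by_contra! h
        exact hb (LinearMap.ext h)
      rcases lt_or_gt_of_ne hx with h | h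
      · exact ⟨-x, fun i => i.elim0, by simpa using h⟩
      · exact ⟨x, fun i => i.elim0, h⟩
  | succ m ih =>
    rcases ih (fun i => A i.succ) b with ⟨u, hu, hb⟩ | ⟨x, hx, hbx⟩
    · left
      refine ⟨Fin.cons 0 u, Fin.cases (by simp) (by simpa using hu), ?_⟩
      rw [Fin.sum_univ_succ]
      simpa using hb
    rcases le_or_gt (A 0 x) 0 with h0 | h0
    · exact Or.inr ⟨x, Fin.cases h0 hx, hbx⟩
    -- Only `A 0` is violated at `x`. After scaling, `y ↦ y - A 0 y • z` projects onto the kernel of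
    -- `A 0`, and the induction hypothesis is applied to the functionals composed with this
    -- projection. The signs at `z` make the recovered coefficient of `A 0` non-negative.
    obtain ⟨z, hz0, hz, hbz⟩ : ∃ z, A 0 z = 1 ∧ (∀ i : Fin m, A i.succ z ≤ 0) ∧ 0 ≤ b z := by
      refine ⟨(A 0 x)⁻¹ • x, ?_, fun i => ?_, ?_⟩
      · simp [h0.ne']
      · have := mul_nonpos_of_nonneg_of_nonpos (inv_nonneg.2 h0.le) (hx i)
        simpa using this
      · have := mul_nonneg (inv_nonneg.2 h0.le) hbx.le
        simpa using this
    rcases ih (fun i => A i.succ - A i.succ z • A 0) (b - b z • A 0) with ⟨u, hu, hb⟩ | ⟨y, hy, hby⟩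
    · left
      refine ⟨Fin.cons (b z - ∑ i, u i * A i.succ z) u,
        Fin.forall_fin_succ.2 ⟨?_, by simpa using hu⟩, ?_⟩
      · have : ∑ i, u i * A i.succ z ≤ 0 :=
          Finset.sum_nonpos fun i _ => mul_nonpos_of_nonneg_of_nonpos (hu i) (hz i)
        simp only [Fin.cons_zero]
        linarith
      · rw [Fin.sum_univ_succ]
        simp only [Fin.cons_zero, Fin.cons_succ]
        rw [sub_eq_iff_eq_add] at hb
        refine hb.trans (LinearMap.ext fun y => ?_)
        simp only [LinearMap.add_apply, LinearMap.sub_apply, LinearMap.sum_apply,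
          LinearMap.smul_apply, smul_eq_mul, mul_sub, sub_mul, Finset.sum_sub_distrib,
          Finset.sum_mul, mul_assoc]
        ring
    · right
      refine ⟨y - A 0 y • z, Fin.forall_fin_succ.2 ⟨?_, fun i => ?_⟩, ?_⟩
      · simp [hz0]
      · have := hy i
        simp only [LinearMap.sub_apply, LinearMap.smul_apply, smul_eq_mul] at this
        simp only [map_sub, map_smul, smul_eq_mul]
        linarith [mul_comm (A 0 y) (A i.succ z)]
      · simp only [LinearMap.sub_apply, LinearMap.smul_apply, smul_eq_mul] at hby
        simp only [map_sub, map_smul, smul_eq_mul]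
        linarith [mul_comm (A 0 y) (b z)]

end OrderedField

/-! ### Small solutions of integer linear systems -/

/-- A rational that is a quotient of integers of absolute value at most `D` has numerator and
denominator at most `D`. -/
theorem Rat.num_den_le_of_eq_div {q : ℚ} {a b : ℤ} {D : ℕ} (hb : b ≠ 0) (hq : q = a / b)
    (ha : a.natAbs ≤ D) (hbD : b.natAbs ≤ D) : q.num.natAbs ≤ D ∧ q.den ≤ D := by
  have hD : 1 ≤ D := (Int.natAbs_pos.2 hb).trans_le hbD
  have h1 : q = Rat.divInt a b := by rw [hq, Rat.divInt_eq_div]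
  refine ⟨?_, ?_⟩
  · by_cases ha0 : a = 0
    · simp [hq, ha0]
    · refine (Nat.le_of_dvd (Int.natAbs_pos.2 ha0) ?_).trans ha
      rw [Int.natAbs_dvd_natAbs, h1]
      exact Rat.num_dvd a hb
  · refine (Nat.le_of_dvd (Int.natAbs_pos.2 hb) ?_).trans hbD
    rw [← Int.natCast_dvd_natCast, Int.dvd_natAbs, h1]
    exact Rat.den_dvd a b

/-- Cramer's rule for the Gram matrix: a solution of a system with linearly independent columns is
a quotient of bounded integers. -/
theorem exists_int_div_of_linearIndependent {κ ι : Type*} [Fintype κ] [Fintype ι] [DecidableEq ι]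
    (A : Matrix κ ι ℤ) (e : κ → ℤ) (w : ι → ℚ) (B : ℕ) (hA : ∀ k i, |A k i| ≤ B)
    (he : ∀ k, |e k| ≤ B) (hw : ∀ k, ∑ i, (A k i : ℚ) * w i = e k)
    (hli : LinearIndependent ℚ fun (i : ι) (k : κ) => (A k i : ℚ)) (i : ι) :
    ∃ a b : ℤ, b ≠ 0 ∧ w i = a / b ∧
      a.natAbs ≤ (Fintype.card ι).factorial * (Fintype.card κ * B ^ 2) ^ Fintype.card ι ∧
      b.natAbs ≤ (Fintype.card ι).factorial * (Fintype.card κ * B ^ 2) ^ Fintype.card ι := by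
  classical
  set G : Matrix ι ι ℤ := A.transpose * A with hG
  set r : ι → ℤ := A.transpose.mulVec e with hr
  have habs : ∀ x y : κ → ℤ, (∀ k, |x k| ≤ B) → (∀ k, |y k| ≤ B) →
      |∑ k, x k * y k| ≤ ((Fintype.card κ * B ^ 2 : ℕ) : ℤ) := by
    intro x y hx hy
    refine (Finset.abs_sum_le_sum_abs _ _).trans ?_
    have : ∀ k ∈ Finset.univ, |x k * y k| ≤ (B : ℤ) ^ 2 := by
      intro k _
      rw [abs_mul, sq]
      exact mul_le_mul (hx k) (hy k) (abs_nonneg _) (by positivity)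
    refine (Finset.sum_le_card_nsmul _ _ _ this).trans ?_
    simp
  have hdet : ∀ M : Matrix ι ι ℤ, (∀ i j, |M i j| ≤ ((Fintype.card κ * B ^ 2 : ℕ) : ℤ)) →
      M.det.natAbs ≤ (Fintype.card ι).factorial * (Fintype.card κ * B ^ 2) ^ Fintype.card ι := by
    intro M hM
    have := Matrix.det_le (A := M) (abv := AbsoluteValue.abs) hM
    rw [AbsoluteValue.abs_apply, Int.abs_eq_natAbs, nsmul_eq_mul] at this
    exact_mod_cast this
  have hGb : ∀ i j, |G i j| ≤ ((Fintype.card κ * B ^ 2 : ℕ) : ℤ) := fun i j =>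
    habs (fun k => A k i) (fun k => A k j) (fun k => hA k i) (fun k => hA k j)
  have hrb : ∀ i, |r i| ≤ ((Fintype.card κ * B ^ 2 : ℕ) : ℤ) := fun i =>
    habs (fun k => A k i) e (fun k => hA k i) he
  let AQ : Matrix κ ι ℚ := A.map (Int.cast)
  have hGQ : G.map (Int.cast : ℤ → ℚ) = AQ.transpose * AQ := by
    ext i j
    simp [hG, AQ, Matrix.mul_apply]
  have hinj : Function.Injective AQ.mulVec :=
    Matrix.mulVec_injective_iff.2 hli
  -- Over `ℚ` the Gram matrix has the same kernel as `AQ`, which is trivial by independence of the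
  -- columns.
  have hdetQ : (AQ.transpose * AQ).det ≠ 0 := by
    intro h0
    obtain ⟨x, hx, hx0⟩ := Matrix.exists_mulVec_eq_zero_iff.2 h0
    have hker : x ∈ LinearMap.ker (AQ.transpose * AQ).mulVecLin := hx0
    rw [Matrix.ker_mulVecLin_transpose_mul_self] at hker
    exact hx (hinj (by simpa using hker))
  have hdetcast : ((G.det : ℤ) : ℚ) = (AQ.transpose * AQ).det := by
    rw [← hGQ]
    exact Int.cast_det G
  have hGdet : G.det ≠ 0 := by
    intro h
    rw [h] at hdetcast
    exact hdetQ (by simpa using hdetcast.symm)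
  refine ⟨(G.updateCol i r).det, G.det, hGdet, ?_, hdet _ fun a b => ?_, hdet _ hGb⟩
  · have hAw : AQ.mulVec w = fun k => (e k : ℚ) := by
      ext k
      rw [← hw k]
      rfl
    have hGw : (AQ.transpose * AQ).mulVec w = fun i => (r i : ℚ) := by
      rw [← Matrix.mulVec_mulVec, hAw]
      ext i
      simp [hr, AQ, Matrix.mulVec, dotProduct]
    have hcr := Matrix.mulVec_cramer (AQ.transpose * AQ) (fun i => (r i : ℚ))
    rw [← hGw, ← Matrix.mulVec_smul] at hcr
    have hinj' : Function.Injective (AQ.transpose * AQ).mulVec :=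
      Matrix.mulVec_injective_of_isUnit
        ((Matrix.isUnit_iff_isUnit_det _).2 (isUnit_iff_ne_zero.2 hdetQ))
    have h1 := congrFun (hinj' hcr) i
    rw [hGw, Matrix.cramer_apply, Pi.smul_apply, smul_eq_mul, ← hdetcast] at h1
    have h2 : ((G.updateCol i r).det : ℚ) =
        ((AQ.transpose * AQ).updateCol i fun i => (r i : ℚ)).det := by
      rw [Int.cast_det, ← hGQ]
      congr 1
      ext a b
      simp only [Matrix.map_apply, Matrix.updateCol_apply]
      split_ifs <;> rfl
    rw [h2, h1, mul_div_cancel_left₀]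
    exact_mod_cast hGdet
  · rw [Matrix.updateCol_apply]
    split_ifs
    · exact hrb a
    · exact hGb a b

/-- An integer linear system with a non-negative rational solution has one in which all numerators
and denominators are small. -/
theorem exists_small_nonneg_solution {κ ι : Type*} [Fintype κ] [Fintype ι] (A : Matrix κ ι ℤ)
    (e : κ → ℤ) (w : ι → ℚ) (B : ℕ) (hB : 1 ≤ B) (hA : ∀ k i, |A k i| ≤ B) (he : ∀ k, |e k| ≤ B)
    (hnonneg : ∀ i, 0 ≤ w i) (hw : ∀ k, ∑ i, (A k i : ℚ) * w i = e k) :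
    ∃ u : ι → ℚ, (∀ i, 0 ≤ u i) ∧ (∀ k, ∑ i, (A k i : ℚ) * u i = e k) ∧
      ∀ i, (u i).num.natAbs ≤
          (Fintype.card κ).factorial * ((Fintype.card κ + 1) * B ^ 2) ^ Fintype.card κ ∧
        (u i).den ≤
          (Fintype.card κ).factorial * ((Fintype.card κ + 1) * B ^ 2) ^ Fintype.card κ := by
  classical
  obtain ⟨u, hu, hsum, hli⟩ := exists_nonneg_sum_eq_linearIndepOn
    (fun (i : ι) (k : κ) => (A k i : ℚ)) w hnonneg
  have hu' : ∀ k, ∑ i, (A k i : ℚ) * u i = e k := by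
    intro k
    have := congrFun hsum k
    simp only [Finset.sum_apply, Pi.smul_apply, smul_eq_mul] at this
    rw [← hw k]
    simpa only [mul_comm] using this
  refine ⟨u, hu, hu', fun i => ?_⟩
  -- The `+ 1` keeps the base positive even when `κ` is empty, so that the power is monotone in its
  -- exponent.
  have hBpos : 1 ≤ (Fintype.card κ + 1) * B ^ 2 := Nat.mul_pos (Nat.succ_pos _) (pow_pos hB 2)
  have hcard : Fintype.card {i // u i ≠ 0} ≤ Fintype.card κ := by
    have : Fintype.card {i // u i ≠ 0} ≤ Module.finrank ℚ (κ → ℚ) :=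
      LinearIndependent.fintype_card_le_finrank hli
    rwa [Module.finrank_fintype_fun_eq_card] at this
  have hbound : (Fintype.card {i // u i ≠ 0}).factorial *
      (Fintype.card κ * B ^ 2) ^ Fintype.card {i // u i ≠ 0} ≤
      (Fintype.card κ).factorial * ((Fintype.card κ + 1) * B ^ 2) ^ Fintype.card κ := by
    refine Nat.mul_le_mul (Nat.factorial_le hcard) ?_
    refine (Nat.pow_le_pow_left (Nat.mul_le_mul_right _ (Nat.le_succ _)) _).trans ?_
    exact Nat.pow_le_pow_right hBpos hcard
  by_cases hi : u i = 0
  · have : 1 ≤ (Fintype.card κ).factorial * ((Fintype.card κ + 1) * B ^ 2) ^ Fintype.card κ :=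
      Nat.mul_pos (Nat.factorial_pos _) (Nat.pow_pos hBpos)
    simp [hi, this]
  · have hsub : ∀ k, ∑ i : {i // u i ≠ 0}, (A k i : ℚ) * u i = e k := by
      intro k
      rw [← hu' k]
      have := Finset.sum_subtype_of_mem (s := Finset.univ.filter fun i => u i ≠ 0)
        (fun i => (A k i : ℚ) * u i) (p := fun i => u i ≠ 0) (by simp)
      rw [Finset.subtype_eq_univ.2 (by simp)] at this
      rw [this]
      refine Finset.sum_subset (Finset.subset_univ _) fun i _ hi => ?_
      have : u i = 0 := by simpa using hi
      simp [this]
    obtain ⟨a, b, hb, hab, ha, hb'⟩ := exists_int_div_of_linearIndependent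
      (A.submatrix id (Subtype.val : {i // u i ≠ 0} → ι)) e (fun i => u i) B
      (fun k i => hA k i) he hsub hli ⟨i, hi⟩
    exact Rat.num_den_le_of_eq_div hb hab (ha.trans hbound) (hb'.trans hbound)

/-! ### Conic consequences of a system -/

namespace LinIneq

variable {n : ℕ}

/-- The coefficient vector over `ℚ`. -/
def ratCoeff (I : LinIneq n) : Fin n → ℚ := fun j => I.coeff j

@[simp]
theorem ratCoeff_apply (I : LinIneq n) (j : Fin n) : I.ratCoeff j = I.coeff j := rfl

@[simp]
theorem integerNegation_integerNegation (I : LinIneq n) :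
    I.integerNegation.integerNegation = I := by
  cases I
  simp [integerNegation]

theorem ratCoeff_integerNegation (I : LinIneq n) : I.integerNegation.ratCoeff = -I.ratCoeff := by
  ext j
  simp [integerNegation]

end LinIneq

namespace LinSystem

variable {n : ℕ}

/-- `Implied F a β`: some non-negative rational combination of the inequalities of `F` has
left-hand side `a x` and right-hand side at least `β`. -/
inductive Implied (F : LinSystem n) : (Fin n → ℚ) → ℚ → Prop
  | hyp {I : LinIneq n} (hI : I ∈ F) : Implied F I.ratCoeff I.rhs
  | zero {β : ℚ} (hβ : β ≤ 0) : Implied F 0 β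
  | add {a b : Fin n → ℚ} {β γ : ℚ} (h : Implied F a β) (h' : Implied F b γ) :
      Implied F (a + b) (β + γ)
  | smul {a : Fin n → ℚ} {β t : ℚ} (ht : 0 ≤ t) (h : Implied F a β) : Implied F (t • a) (t * β)

namespace Implied

variable {F G : LinSystem n} {a b : Fin n → ℚ} {β γ : ℚ}

theorem mono_rhs (h : Implied F a β) (hγ : γ ≤ β) : Implied F a γ := by
  have := h.add (zero (β := γ - β) (by linarith))
  simpa using this

theorem of_eq (h : Implied F a β) (hab : a = b) (hγ : γ ≤ β) : Implied F b γ :=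
  hab ▸ h.mono_rhs hγ

theorem trans (h : Implied F a β) (hG : ∀ I ∈ F, Implied G I.ratCoeff I.rhs) : Implied G a β := by
  induction h with
  | hyp hI => exact hG _ hI
  | zero hβ => exact zero hβ
  | add _ _ h h' => exact h.add h'
  | smul ht _ h => exact h.smul ht

theorem mono (h : Implied F a β) (hFG : ∀ I ∈ F, I ∈ G) : Implied G a β :=
  h.trans fun I hI => hyp (hFG I hI)

theorem sum {ι : Type*} (s : Finset ι) (c : ι → Fin n → ℚ) (r : ι → ℚ)
    (h : ∀ i ∈ s, Implied F (c i) (r i)) : Implied F (∑ i ∈ s, c i) (∑ i ∈ s, r i) := by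
  classical
  induction s using Finset.induction_on with
  | empty => exact zero le_rfl
  | insert i s hi ih =>
    rw [Finset.sum_insert hi, Finset.sum_insert hi]
    exact (h i (Finset.mem_insert_self _ _)).add
      (ih fun j hj => h j (Finset.mem_insert_of_mem hj))

theorem of_weights (w : Fin F.length → ℚ) (hw : ∀ i, 0 ≤ w i)
    (ha : ∀ j, ∑ i, w i * ((F.get i).coeff j : ℚ) = a j)
    (hβ : β ≤ ∑ i, w i * ((F.get i).rhs : ℚ)) : Implied F a β := by
  have := sum (F := F) Finset.univ (fun i => w i • (F.get i).ratCoeff)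
    (fun i => w i * ((F.get i).rhs : ℚ))
    fun i _ => (hyp (List.get_mem F i)).smul (hw i)
  refine this.of_eq ?_ hβ
  ext j
  simpa using ha j

theorem exists_weights (h : Implied F a β) : ∃ w : Fin F.length → ℚ, (∀ i, 0 ≤ w i) ∧
    (∀ j, ∑ i, w i * ((F.get i).coeff j : ℚ) = a j) ∧
    β ≤ ∑ i, w i * ((F.get i).rhs : ℚ) := by
  induction h with
  | @hyp I hI =>
    obtain ⟨i, rfl⟩ := List.mem_iff_get.1 hI
    refine ⟨Pi.single i 1, fun k => ?_, fun j => ?_, ?_⟩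
    · by_cases hk : k = i
      · subst hk
        simp
      · simp [hk]
    · simp [Pi.single_apply, ite_mul]
    · simp [Pi.single_apply, ite_mul]
  | zero hβ => exact ⟨0, by simp, by simp, by simpa using hβ⟩
  | add _ _ h h' =>
    obtain ⟨w, hw, hc, hr⟩ := h
    obtain ⟨w', hw', hc', hr'⟩ := h'
    refine ⟨w + w', fun i => add_nonneg (hw i) (hw' i), fun j => ?_, ?_⟩
    · simp only [Pi.add_apply, add_mul, Finset.sum_add_distrib, hc, hc']
    · simp only [Pi.add_apply, add_mul, Finset.sum_add_distrib]
      exact add_le_add hr hr'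
  | @smul _ _ t ht _ h =>
    obtain ⟨w, hw, hc, hr⟩ := h
    refine ⟨t • w, fun i => mul_nonneg ht (hw i), fun j => ?_, ?_⟩
    · simp only [Pi.smul_apply, smul_eq_mul, mul_assoc, ← Finset.mul_sum, hc]
    · simp only [Pi.smul_apply, smul_eq_mul, mul_assoc, ← Finset.mul_sum]
      exact mul_le_mul_of_nonneg_left hr ht

/-- A contradiction from an inequality and a system is a bound on that inequality. -/
theorem of_cons_contradiction {q : LinIneq n} (h : Implied (q :: F) 0 1) :
    Implied F 0 1 ∨ ∃ ε : ℚ, 0 < ε ∧ Implied F (-q.ratCoeff) (-q.rhs + ε) := by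
  obtain ⟨w, hw, hc, hr⟩ := h.exists_weights
  simp only [List.length_cons, Fin.sum_univ_succ, List.get_eq_getElem, Fin.val_zero,
    List.getElem_cons_zero, Fin.val_succ, List.getElem_cons_succ] at hc hr
  -- If `q` has weight zero, the contradiction comes from `F` alone; otherwise dividing by that
  -- weight leaves the slack `ε = (w 0)⁻¹`.
  by_cases h0 : w 0 = 0
  · left
    refine of_weights (fun i => w i.succ) (fun i => hw _) (fun j => ?_) ?_
    · simpa [h0] using hc j
    · simpa [h0] using hr
  · right
    have hpos : 0 < w 0 := lt_of_le_of_ne (hw 0) (Ne.symm h0)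
    have h1 : Implied F (-(w 0) • q.ratCoeff) (1 - w 0 * q.rhs) := by
      refine of_weights (fun i => w i.succ) (fun i => hw _) (fun j => ?_) ?_
      · have := hc j
        simp only [Pi.zero_apply] at this
        simp only [List.get_eq_getElem, Pi.smul_apply, LinIneq.ratCoeff_apply, smul_eq_mul]
        linarith
      · simp only [List.get_eq_getElem]
        linarith
    refine ⟨(w 0)⁻¹, inv_pos.2 hpos, (h1.smul (inv_nonneg.2 hpos.le)).of_eq ?_ (le_of_eq ?_)⟩
    · rw [smul_smul, mul_neg, inv_mul_cancel₀ h0, neg_one_smul]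
    · field_simp
      ring

end Implied

/-! ### Farkas' lemma for polyhedra -/

/-- The functional `(x, t) ↦ b t - a x`. -/
def homogenize (a : Fin n → ℚ) (b : ℚ) : (Fin n → ℚ) × ℚ →ₗ[ℚ] ℚ :=
  b • LinearMap.snd ℚ _ _ - (∑ j, a j • LinearMap.proj j) ∘ₗ LinearMap.fst ℚ _ _

theorem homogenize_apply (a : Fin n → ℚ) (b : ℚ) (x : Fin n → ℚ) (t : ℚ) :
    homogenize a b (x, t) = b * t - ∑ j, a j * x j := by
  simp [homogenize]

/-- Farkas' lemma for the homogenized system in `(x, t)`. The extra functional `-t` provides the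
slack in the right-hand side on one side of the alternative and `0 ≤ t` on the other. A separating
pair with `t > 0` is a point `x / t` of the polyhedron; one with `t = 0` is a recession direction.
-/
theorem implied_or_exists_separating (F : LinSystem n) (c : Fin n → ℚ) (d : ℚ) :
    Implied F c d ∨ ∃ (x : Fin n → ℚ) (t : ℚ), 0 ≤ t ∧
      (∀ I ∈ F, (I.rhs : ℚ) * t ≤ ∑ j, (I.coeff j : ℚ) * x j) ∧ ∑ j, c j * x j < d * t := by
  rcases farkas_functional (Fin.cons (homogenize 0 (-1))
      fun i : Fin F.length => homogenize (F.get i).ratCoeff (F.get i).rhs) (homogenize c d) with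
    ⟨u, hu, h⟩ | ⟨⟨x, t⟩, h, hlt⟩
  · left
    rw [Fin.sum_univ_succ] at h
    refine Implied.of_weights (fun i => u i.succ) (fun i => hu _) (fun j => ?_) ?_
    · have := LinearMap.congr_fun h (Pi.single j 1, 0)
      simp only [LinearMap.add_apply, LinearMap.smul_apply, LinearMap.sum_apply, Fin.cons_zero,
        Fin.cons_succ, homogenize_apply] at this
      simpa [Pi.single_apply, eq_comm] using this
    · have := LinearMap.congr_fun h (0, 1)
      simp only [LinearMap.add_apply, LinearMap.smul_apply, LinearMap.sum_apply, Fin.cons_zero,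
        Fin.cons_succ, homogenize_apply] at this
      have h0 := hu 0
      simp at this ⊢
      linarith
  · right
    rw [Fin.forall_fin_succ] at h
    simp only [Fin.cons_zero, Fin.cons_succ, homogenize_apply] at h hlt
    refine ⟨x, t, by simpa using h.1, fun I hI => ?_, by linarith⟩
    obtain ⟨i, rfl⟩ := List.mem_iff_get.1 hI
    have := h.2 i
    simp only [LinIneq.ratCoeff_apply] at this
    linarith

theorem ratCast_mem_polyhedron {F : LinSystem n} {x : Fin n → ℚ}
    (hx : ∀ I ∈ F, (I.rhs : ℚ) ≤ ∑ j, (I.coeff j : ℚ) * x j) :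
    (fun j => (x j : ℝ)) ∈ F.polyhedron := by
  intro I hI
  have := hx I hI
  simp only [LinIneq.halfspace, Set.mem_ofPred_eq]
  exact_mod_cast this

theorem div_mem_polyhedron {F : LinSystem n} {x : Fin n → ℚ} {t : ℚ} (ht : 0 < t)
    (hx : ∀ I ∈ F, (I.rhs : ℚ) * t ≤ ∑ j, (I.coeff j : ℚ) * x j) (I : LinIneq n) (hI : I ∈ F) :
    (I.rhs : ℚ) ≤ ∑ j, (I.coeff j : ℚ) * (x j / t) := by
  have := hx I hI
  rw [← le_div_iff₀ ht, Finset.sum_div] at this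
  simpa only [mul_div_assoc] using this

theorem implied_contradiction_of_polyhedron_eq_empty {F : LinSystem n} (h : F.polyhedron = ∅) :
    Implied F 0 1 := by
  rcases implied_or_exists_separating F 0 1 with h' | ⟨x, t, _, hx, hlt⟩
  · exact h'
  · have ht : 0 < t := by simpa using hlt
    have := ratCast_mem_polyhedron (div_mem_polyhedron ht hx)
    simp [h] at this

theorem implied_of_polyhedron_subset_halfspace {F : LinSystem n} {I : LinIneq n}
    (h : F.polyhedron ⊆ I.halfspace) : Implied F I.ratCoeff I.rhs ∨ Implied F 0 1 := by
  have hrat : ∀ x : Fin n → ℚ, (∀ J ∈ F, (J.rhs : ℚ) ≤ ∑ j, (J.coeff j : ℚ) * x j) →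
      (I.rhs : ℚ) ≤ ∑ j, (I.coeff j : ℚ) * x j := by
    intro x hx
    have := h (ratCast_mem_polyhedron hx)
    simp only [LinIneq.halfspace, Set.mem_ofPred_eq] at this
    exact_mod_cast this
  rcases implied_or_exists_separating F I.ratCoeff I.rhs with h' | ⟨x, t, ht, hx, hlt⟩
  · exact Or.inl h'
  rcases ht.eq_or_lt with rfl | ht
  · right
    rcases implied_or_exists_separating F 0 1 with h0 | ⟨y, s, _, hy, hs⟩
    · exact h0
    exfalso
    have hs : 0 < s := by simpa using hs
    have hy := div_mem_polyhedron hs hy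
    simp only [mul_zero, LinIneq.ratCoeff_apply] at hx hlt
    set v := ∑ j, (I.coeff j : ℚ) * x j with hv
    set u := ∑ j, (I.coeff j : ℚ) * (y j / s) with hu
    -- Along the recession direction `x` the left-hand side of `I` decreases without bound, so a
    -- long enough step from the point `y / s` leaves the half-space while staying in the
    -- polyhedron.
    obtain ⟨r, hr, hr'⟩ : ∃ r : ℚ, 0 ≤ r ∧ u + r * v < I.rhs := by
      refine ⟨(|I.rhs - u| + 1) / -v, by have := neg_pos.2 hlt; positivity, ?_⟩
      have : (|I.rhs - u| + 1) / -v * v = -(|I.rhs - u| + 1) := by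
        have := hlt.ne
        field_simp
      rw [this]
      have := neg_abs_le ((I.rhs : ℚ) - u)
      linarith
    have := hrat (fun j => y j / s + r * x j) fun J hJ => by
      have h1 := hy J hJ
      have h2 := mul_nonneg hr (hx J hJ)
      simp only [mul_add, Finset.sum_add_distrib, mul_left_comm _ r, ← Finset.mul_sum]
      linarith
    simp only [mul_add, Finset.sum_add_distrib, mul_left_comm _ r, ← Finset.mul_sum, ← hu,
      ← hv] at this
    linarith
  · exfalso
    have := hrat _ (div_mem_polyhedron ht hx)
    simp only [← mul_div_assoc, ← Finset.sum_div] at this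
    rw [le_div_iff₀ ht] at this
    simp only [LinIneq.ratCoeff_apply] at hlt
    linarith

/-! ### Refutations by rounding cuts -/

/-- `CutRefutable F k`: a contradiction follows from `F` after adding at most `k` inequalities, each
of them a conic consequence of the previous ones with its right-hand side rounded up. -/
inductive CutRefutable : LinSystem n → ℕ → Prop
  | contradiction {F : LinSystem n} (k : ℕ) (h : Implied F 0 1) : CutRefutable F k
  | cut {F : LinSystem n} {k : ℕ} (I : LinIneq n) (β : ℚ) (h : Implied F I.ratCoeff β)
      (hβ : (I.rhs : ℚ) < β + 1) (hk : CutRefutable (I :: F) k) : CutRefutable F (k + 1)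

namespace CutRefutable

variable {F G : LinSystem n} {k l : ℕ}

theorem mono (h : CutRefutable F k) (hFG : ∀ I ∈ F, Implied G I.ratCoeff I.rhs) (hkl : k ≤ l) :
    CutRefutable G l := by
  induction h generalizing G l with
  | contradiction k h => exact contradiction l (h.trans hFG)
  | cut I β h hβ _ ih =>
    obtain ⟨l, rfl⟩ : ∃ l', l = l' + 1 := ⟨l - 1, by omega⟩
    refine cut I β (h.trans hFG) hβ (ih (fun J hJ => ?_) (by omega))
    rcases List.mem_cons.1 hJ with rfl | hJ
    · exact Implied.hyp List.mem_cons_self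
    · exact (hFG J hJ).mono fun _ => List.mem_cons_of_mem _

/-- Consequences of the inequalities `J`, for which `J - K q` follows from `G`, follow from `G`
after subtracting a multiple of `q`. -/
theorem _root_.LinSystem.Implied.exists_sub_smul {q : LinIneq n}
    (hq : Implied G (-q.ratCoeff) (-q.rhs))
    (hFG : ∀ J ∈ F, ∃ K : ℕ, Implied G (J.ratCoeff - (K : ℚ) • q.ratCoeff) (J.rhs - K * q.rhs))
    {a : Fin n → ℚ} {β : ℚ} (h : Implied F a β) :
    ∃ K : ℕ, 0 < K ∧ Implied G (a - (K : ℚ) • q.ratCoeff) (β - K * q.rhs) := by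
  -- A rational multiplier suffices: as `-q` is valid, it can be raised to any larger integer, in
  -- particular to a positive one.
  suffices h' : ∃ κ : ℚ, 0 ≤ κ ∧ Implied G (a - κ • q.ratCoeff) (β - κ * q.rhs) by
    obtain ⟨κ, _, h⟩ := h'
    obtain ⟨K, hK⟩ := exists_nat_gt κ
    refine ⟨K + 1, K.succ_pos, (h.add (hq.smul (t := (K : ℚ) + 1 - κ) (by linarith))).of_eq ?_
      (le_of_eq ?_)⟩
    · ext j
      simp
      ring
    · push_cast
      ring
  induction h with
  | hyp hI =>
    obtain ⟨K, hK⟩ := hFG _ hI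
    exact ⟨K, K.cast_nonneg, hK⟩
  | zero hβ => exact ⟨0, le_rfl, (Implied.zero hβ).of_eq (by simp) (by simp)⟩
  | add _ _ h h' =>
    obtain ⟨κ, hκ, h⟩ := h
    obtain ⟨κ', hκ', h'⟩ := h'
    refine ⟨κ + κ', add_nonneg hκ hκ', (h.add h').of_eq ?_ (le_of_eq ?_)⟩
    · ext j
      simp
      ring
    · ring
  | @smul _ _ t ht _ h =>
    obtain ⟨κ, hκ, h⟩ := h
    refine ⟨t * κ, mul_nonneg ht hκ, (h.smul ht).of_eq ?_ (le_of_eq ?_)⟩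
    · ext j
      simp
      ring
    · ring

/-- If `q.coeff x ≤ q.rhs` is valid, then a refutation on the face `q.coeff x = q.rhs` can be turned
into a derivation of the integer negation of `q`. -/
theorem lift_face {q : LinIneq n} (h : CutRefutable F k)
    (hq : Implied G (-q.ratCoeff) (-q.rhs))
    (hFG : ∀ J ∈ F, ∃ K : ℕ, Implied G (J.ratCoeff - (K : ℚ) • q.ratCoeff) (J.rhs - K * q.rhs))
    (hG : CutRefutable (q.integerNegation :: G) l) : CutRefutable G (k + l + 1) := by
  induction h generalizing G with
  | contradiction k h =>
    obtain ⟨K, hK0, hK⟩ := Implied.exists_sub_smul hq hFG h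
    have hK0 : (0 : ℚ) < K := by exact_mod_cast hK0
    -- The lifted contradiction, divided by `K`, exceeds `-q.rhs` by `1 / K`, so it rounds up to `1
    -- - q.rhs`.
    refine mono (cut q.integerNegation (-q.rhs + (K : ℚ)⁻¹) ?_ ?_ hG)
      (fun I hI => Implied.hyp hI) (by omega : l + 1 ≤ k + l + 1)
    · refine (hK.smul (inv_nonneg.2 hK0.le)).of_eq ?_ (le_of_eq ?_)
      · rw [zero_sub, smul_neg, smul_smul, inv_mul_cancel₀ hK0.ne', one_smul,
          LinIneq.ratCoeff_integerNegation]
      · field_simp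
        ring
    · have := inv_pos.2 hK0
      simp only [LinIneq.integerNegation]
      push_cast
      linarith
  | @cut F k I β h hβ _ ih =>
    obtain ⟨K, hK0, hK⟩ := Implied.exists_sub_smul hq hFG h
    -- As `K` and `q` are integral, subtracting `K q` commutes with rounding.
    let I' : LinIneq n := ⟨fun j => I.coeff j - K * q.coeff j, I.rhs - K * q.rhs⟩
    have hI' : I'.ratCoeff = I.ratCoeff - (K : ℚ) • q.ratCoeff := by
      ext j
      simp [I']
    have hcons : ∀ J ∈ G, J ∈ I' :: G := fun _ => List.mem_cons_of_mem _
    refine mono (cut (k := k + l + 1) I' (β - K * q.rhs) (hI' ▸ hK) ?_ (ih (hq.mono hcons) ?_ ?_))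
      (fun I hI => Implied.hyp hI) (by omega)
    · simp only [I']
      push_cast
      linarith
    · intro J hJ
      rcases List.mem_cons.1 hJ with rfl | hJ
      · refine ⟨K, (Implied.hyp List.mem_cons_self).of_eq hI' (le_of_eq ?_)⟩
        simp [I']
      · obtain ⟨K, hK⟩ := hFG J hJ
        exact ⟨K, hK.mono hcons⟩
    · refine mono hG (fun J hJ => Implied.hyp ?_) le_rfl
      rcases List.mem_cons.1 hJ with rfl | hJ
      · exact List.mem_cons_self
      · exact List.mem_cons_of_mem _ (hcons J hJ)

theorem of_inter_halfspace_eq_empty {q : LinIneq n} (h : F.polyhedron ∩ q.halfspace = ∅)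
    (hk : CutRefutable (q.integerNegation :: F) k) : CutRefutable F (k + 1) := by
  have hempty : polyhedron (q :: F) = ∅ := by
    rw [← h]
    ext x
    simp [polyhedron, and_comm]
  rcases (implied_contradiction_of_polyhedron_eq_empty hempty).of_cons_contradiction with
    h | ⟨ε, hε, h⟩
  · exact contradiction _ h
  · refine cut _ _ (q.ratCoeff_integerNegation ▸ h) ?_ hk
    simp only [LinIneq.integerNegation]
    push_cast
    linarith

/-- Otherwise a segment in the polyhedron from `x` to `y` crosses the hyperplane of `q` strictly
between its ends. Both `y` and the crossing point lie on the face, where `c` has value `e`; by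
linearity `c` has value `e` at `x` too, which puts `x` on the face and hence in the half-space. -/
theorem _root_.LinSystem.subset_halfspace_or_of_isFaceOf {q : LinIneq n}
    (h : IsFaceOf F.polyhedron (F.polyhedron ∩ q.halfspace)) :
    F.polyhedron ⊆ q.halfspace ∨
      F.polyhedron ⊆ (⟨fun j => -q.coeff j, -q.rhs⟩ : LinIneq n).halfspace := by
  by_contra! hcon
  obtain ⟨⟨x, hxP, hx⟩, y, hyP, hy⟩ := And.imp Set.not_subset.1 Set.not_subset.1 hcon
  obtain ⟨c, e, ⟨_, hmax⟩, hface⟩ := h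
  have hcx : ∑ j, c j * x j ≤ e := hmax ⟨x, hxP, rfl⟩
  simp only [LinIneq.halfspace, Set.mem_ofPred_eq, not_le, Int.cast_neg, neg_mul,
    Finset.sum_neg_distrib, neg_lt_neg_iff] at hx hy
  have hcy : ∑ j, c j * y j = e := by
    have : y ∈ F.polyhedron ∩ q.halfspace := ⟨hyP, hy.le⟩
    rw [hface] at this
    exact this.2
  set a := ∑ j, (q.coeff j : ℝ) * x j with ha
  set b := ∑ j, (q.coeff j : ℝ) * y j with hb
  have hab : 0 < b - a := by linarith
  obtain ⟨ε, hε0, hε1, hε⟩ : ∃ ε : ℝ, 0 < ε ∧ ε ≤ 1 ∧ (1 - ε) * b + ε * a = q.rhs := by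
    refine ⟨(b - q.rhs) / (b - a), div_pos (by linarith) hab, ?_, ?_⟩
    · rw [div_le_one hab]
      linarith
    · field_simp
      ring
  have hcomb : ∀ d : Fin n → ℝ, ∑ j, d j * ((1 - ε) * y j + ε * x j) =
      (1 - ε) * ∑ j, d j * y j + ε * ∑ j, d j * x j := by
    intro d
    simp only [Finset.mul_sum, ← Finset.sum_add_distrib]
    exact Finset.sum_congr rfl fun j _ => by ring
  have hz : (fun j => (1 - ε) * y j + ε * x j) ∈ F.polyhedron ∩ q.halfspace := by
    refine ⟨fun I hI => ?_, ?_⟩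
    · have h1 : (I.rhs : ℝ) ≤ _ := hyP I hI
      have h2 : (I.rhs : ℝ) ≤ _ := hxP I hI
      simp only [LinIneq.halfspace, Set.mem_ofPred_eq, hcomb]
      nlinarith
    · simp only [LinIneq.halfspace, Set.mem_ofPred_eq, hcomb, ← ha, ← hb]
      exact hε.ge
  rw [hface] at hz
  have hz2 := hz.2
  simp only [Set.mem_ofPred_eq, hcomb, hcy] at hz2
  have hxe : ∑ j, c j * x j = e := by
    have : ε * (∑ j, c j * x j) = ε * e := by linarith
    exact mul_left_cancel₀ hε0.ne' this
  have hxG : x ∈ F.polyhedron ∩ q.halfspace := by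
    rw [hface]
    exact ⟨hxP, hxe⟩
  exact absurd hxG.2 (not_le.2 hx)

theorem inter_integerNegation_eq_empty {q : LinIneq n} {P : Set (Fin n → ℝ)}
    (h : P ⊆ q.halfspace) : P ∩ q.integerNegation.halfspace = ∅ := by
  rw [Set.eq_empty_iff_forall_notMem]
  rintro x ⟨hx, hx'⟩
  have h1 : (q.rhs : ℝ) ≤ _ := h hx
  simp only [LinIneq.halfspace, LinIneq.integerNegation, Set.mem_ofPred_eq, Int.cast_neg, neg_mul,
    Finset.sum_neg_distrib, Int.cast_sub, Int.cast_one] at hx'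
  linarith

theorem of_query {q : LinIneq n} (hl : CutRefutable (q.integerNegation :: F) k)
    (hr : CutRefutable (q :: F) l)
    (h : F.polyhedron ∩ q.halfspace = ∅ ∨ IsFaceOf F.polyhedron (F.polyhedron ∩ q.halfspace)) :
    CutRefutable F (k + l + 1) := by
  rcases h with h | h
  · exact (of_inter_halfspace_eq_empty h hl).mono (fun I hI => .hyp hI) (by omega)
  rcases subset_halfspace_or_of_isFaceOf h with h | h
  · refine (of_inter_halfspace_eq_empty (q := q.integerNegation)
      (inter_integerNegation_eq_empty h) (k := l) ?_).mono (fun I hI => .hyp hI) (by omega)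
    rwa [LinIneq.integerNegation_integerNegation]
  rcases implied_of_polyhedron_subset_halfspace h with h | h
  · have hq : Implied F (-q.ratCoeff) (-q.rhs) := by
      refine h.of_eq ?_ (by simp)
      ext j
      simp
    rw [Nat.add_comm k]
    refine lift_face hr hq (fun J hJ => ?_) hl
    rcases List.mem_cons.1 hJ with rfl | hJ
    -- On `q` itself `K = 1` leaves the trivial inequality; the inequalities of `F` need `K = 0`.
    · exact ⟨1, (Implied.zero le_rfl).of_eq (by simp) (by simp)⟩
    · exact ⟨0, (Implied.hyp hJ).of_eq (by simp) (by simp)⟩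
  · exact contradiction _ h

theorem of_facelike (T : SPRefutation F) (hT : T.Facelike) : CutRefutable F T.queries := by
  induction T with
  | leaf F w nonneg coeff_eq rhs_eq =>
    exact contradiction _ (.of_weights w nonneg coeff_eq rhs_eq.ge)
  | node F q left right ihl ihr =>
    obtain ⟨hq, hl, hr⟩ := hT
    rcases hq with hq | hq
    -- The mirror case: the query is replaced by its integer negation and the two subtrees change
    -- places.
    · have := of_query (q := q.integerNegation) (k := right.queries) (l := left.queries) (F := F)
        (by simpa using ihr hr) (ihl hl) hq
      rwa [Nat.add_comm right.queries] at this
    · exact of_query (ihl hl) (ihr hr) hq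

end CutRefutable

end LinSystem

/-! ### From rounding cuts to Cutting Planes -/

/-- Every line of `L` belongs to `F` or follows from the lines before it. -/
def CPValid {n : ℕ} (F : LinSystem n) (L : List (LinIneq n)) : Prop :=
  ∀ (i : ℕ) (hi : i < L.length), CPStep F (L.take i) L[i]

section CPValid

variable {n : ℕ} {F : LinSystem n} {L : List (LinIneq n)}

theorem CPValid.concat (hL : CPValid F L) {I : LinIneq n} (hI : CPStep F L I) :
    CPValid F (L ++ [I]) := by
  intro i hi
  rcases Nat.lt_or_ge i L.length with h | h
  · rw [List.take_append_of_le_length h.le, List.getElem_append_left h]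
    exact hL i h
  · obtain rfl : i = L.length := by
      simp at hi
      omega
    simpa using hI

theorem CPStep.of_mem {J : LinIneq n} (hJ : J ∈ F ∨ J ∈ L) : CPStep F L J := by
  rcases hJ with hJ | hJ
  · exact .hyp J hJ
  · have := CPStep.linComb (F := F) J J hJ hJ 1 0
    simpa [LinIneq.linComb] using this

theorem Rat.exists_common_denominator {ι : Type*} [Fintype ι] (w : ι → ℚ) (hw : ∀ i, 0 ≤ w i) :
    ∃ (D : ℕ) (N : ι → ℕ), 0 < D ∧ ∀ i, w i = N i / D := by
  have hD : 0 < ∏ i, (w i).den := Finset.prod_pos fun i _ => (w i).den_pos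
  have : ∀ i, ∃ N : ℕ, w i = N / (∏ i, (w i).den : ℕ) := by
    intro i
    obtain ⟨c, hc⟩ := Finset.dvd_prod_of_mem (fun i => (w i).den) (Finset.mem_univ i)
    have hc0 : (c : ℚ) ≠ 0 := by
      rintro h
      simp [Nat.cast_eq_zero.1 h] at hc
      omega
    refine ⟨(w i).num.toNat * c, ?_⟩
    have hnum : (((w i).num.toNat : ℤ) : ℚ) = (w i).num := by
      rw [Int.toNat_of_nonneg (Rat.num_nonneg.2 (hw i))]
    rw [hc, Nat.cast_mul, Nat.cast_mul, mul_div_mul_right _ _ hc0]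
    conv_lhs => rw [← Rat.num_div_den (w i)]
    rw [← hnum, Int.cast_natCast]
  choose N hN using this
  exact ⟨_, N, hD, hN⟩

namespace CPValid

variable {G : LinSystem n}

/-- The sum is accumulated from the zero inequality `0 · J₀ + 0 · J₀`, which is why an element of
`F` is needed. Each further term costs two lines: a copy of the summand and one linear combination.
-/
theorem exists_append_natCombination (hL : CPValid F L) {J₀ : LinIneq n} (hJ₀ : J₀ ∈ F)
    (hG : ∀ J ∈ G, J ∈ F ∨ J ∈ L) (N : Fin G.length → ℕ) (s : Finset (Fin G.length)) :
    ∃ M, CPValid F (L ++ M) ∧ M.length = 2 * s.card + 2 ∧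
      (⟨fun j => ∑ i ∈ s, (N i : ℤ) * (G.get i).coeff j, ∑ i ∈ s, (N i : ℤ) * (G.get i).rhs⟩ :
        LinIneq n) ∈ L ++ M := by
  classical
  induction s using Finset.induction_on with
  | empty =>
    have h1 := hL.concat (.hyp J₀ hJ₀)
    have h2 := h1.concat (.linComb J₀ J₀ (by simp) (by simp) 0 0)
    refine ⟨[J₀, LinIneq.linComb 0 0 J₀ J₀], by simpa using h2, rfl, ?_⟩
    simp [LinIneq.linComb]
  | insert i s hi ih =>
    obtain ⟨M, hM, hlen, hmem⟩ := ih
    have hJ : G.get i ∈ F ∨ G.get i ∈ L ++ M :=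
      (hG _ (List.get_mem G i)).imp id (List.mem_append_left _)
    have h1 := hM.concat (.of_mem hJ)
    have h2 := h1.concat (.linComb _ (G.get i) (List.mem_append_left _ hmem) (by simp) 1 (N i))
    refine ⟨_, by simpa only [List.append_assoc] using h2, ?_, ?_⟩
    · simp [hlen, Finset.card_insert_of_notMem hi]
      omega
    · simp [LinIneq.linComb, Finset.sum_insert hi, add_comm]

/-- A conic combination of available lines, with its right-hand side rounded up, can be derived in a
number of lines that is linear in the dimension. -/
theorem exists_append_cut (hL : CPValid F L) {J₀ : LinIneq n} (hJ₀ : J₀ ∈ F)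
    (hG : ∀ J ∈ G, J ∈ F ∨ J ∈ L) (w : Fin G.length → ℚ) (hw : ∀ i, 0 ≤ w i) (a : Fin n → ℤ)
    (ha : ∀ j, ∑ i, w i * ((G.get i).coeff j : ℚ) = a j) :
    ∃ M, CPValid F (L ++ (M ++ [⟨a, ⌈∑ i, w i * ((G.get i).rhs : ℚ)⌉⟩])) ∧
      M.length ≤ 2 * n + 4 := by
  classical
  -- Carathéodory is applied to coefficients and right-hand side jointly, in dimension `n + 1`, so
  -- that the bound is preserved exactly.
  obtain ⟨u, hu, hsum, hli⟩ := exists_nonneg_sum_eq_linearIndepOn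
    (fun i => ((G.get i).ratCoeff, ((G.get i).rhs : ℚ))) w hw
  have hcard : (Finset.univ.filter fun i => u i ≠ 0).card ≤ n + 1 := by
    have : Fintype.card {i // u i ≠ 0} ≤ Module.finrank ℚ ((Fin n → ℚ) × ℚ) :=
      LinearIndependent.fintype_card_le_finrank hli
    rw [Fintype.card_subtype] at this
    simpa using this
  have hc : ∀ j, ∑ i, u i * ((G.get i).coeff j : ℚ) = a j := by
    intro j
    have := congrFun (congrArg Prod.fst hsum) j
    simp only [Prod.fst_sum, Prod.smul_fst, Finset.sum_apply, Pi.smul_apply, smul_eq_mul,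
      LinIneq.ratCoeff_apply] at this
    rw [this, ha j]
  have hr : ∑ i, u i * ((G.get i).rhs : ℚ) = ∑ i, w i * ((G.get i).rhs : ℚ) := by
    have := congrArg Prod.snd hsum
    simpa only [Prod.snd_sum, Prod.smul_snd, smul_eq_mul] using this
  obtain ⟨D, N, hD, hN⟩ := Rat.exists_common_denominator u hu
  have hDQ : (D : ℚ) ≠ 0 := by exact_mod_cast hD.ne'
  obtain ⟨M, hM, hlen, hmem⟩ := hL.exists_append_natCombination hJ₀ hG N
    (Finset.univ.filter fun i => u i ≠ 0)
  have hscale : ∀ f : Fin G.length → ℤ,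
      ((∑ i ∈ Finset.univ.filter (fun i => u i ≠ 0), (N i : ℤ) * f i : ℤ) : ℚ) =
        (∑ i, u i * (f i : ℚ)) * D := by
    intro f
    rw [Finset.sum_mul, Finset.sum_filter]
    push_cast
    refine Finset.sum_congr rfl fun i _ => ?_
    split_ifs with hi
    · rw [hN i]
      field_simp
    · simp [not_not.1 hi]
  have hcoeff : ∀ j, ∑ i ∈ Finset.univ.filter (fun i => u i ≠ 0), (N i : ℤ) * (G.get i).coeff j =
      D * a j := by
    intro j
    have := hscale fun i => (G.get i).coeff j
    rw [hc j, mul_comm] at this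
    exact_mod_cast this
  refine ⟨M, ?_, by omega⟩
  have hdiv := hM.concat (.division _ hmem D hD fun j => ⟨a j, hcoeff j⟩)
  have hline : LinIneq.divide D (⟨fun j => ∑ i ∈ Finset.univ.filter (fun i => u i ≠ 0),
      (N i : ℤ) * (G.get i).coeff j, ∑ i ∈ Finset.univ.filter (fun i => u i ≠ 0),
      (N i : ℤ) * (G.get i).rhs⟩ : LinIneq n) = ⟨a, ⌈∑ i, w i * ((G.get i).rhs : ℚ)⌉⟩ := by
    simp only [LinIneq.divide, LinIneq.mk.injEq]
    refine ⟨funext fun j => ?_, ?_⟩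
    · rw [hcoeff j, Int.mul_ediv_cancel_left _ (by exact_mod_cast hD.ne')]
    · rw [hscale, mul_div_cancel_right₀ _ hDQ, hr]
  rw [hline, List.append_assoc] at hdiv
  exact hdiv

/-- Rescaling the weights makes the right-hand side exactly `1`, so rounding leaves it unchanged. -/
theorem exists_append_falsum_of_implied (hL : CPValid F L) {J₀ : LinIneq n} (hJ₀ : J₀ ∈ F)
    (hG : ∀ J ∈ G, J ∈ F ∨ J ∈ L) (h : G.Implied 0 1) :
    ∃ M, CPValid F (L ++ (M ++ [LinIneq.falsum n])) ∧ M.length + 1 ≤ (0 + 1) * (2 * n + 5) := by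
  obtain ⟨w, hw, hc, hr⟩ := h.exists_weights
  set r := ∑ i, w i * ((G.get i).rhs : ℚ) with hrdef
  have hr0 : 0 < r := by linarith
  obtain ⟨M, hM, hlen⟩ := hL.exists_append_cut hJ₀ hG (fun i => r⁻¹ * w i)
    (fun i => mul_nonneg (inv_nonneg.2 hr0.le) (hw i)) (fun _ => 0) fun j => by
      simp only [mul_assoc, ← Finset.mul_sum, hc j]
      simp
  simp only [mul_assoc, ← Finset.mul_sum, ← hrdef, inv_mul_cancel₀ hr0.ne', Int.ceil_one] at hM
  exact ⟨M, hM, by omega⟩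

open LinSystem in
theorem exists_append_falsum {k : ℕ} (h : CutRefutable G k) (hL : CPValid F L) {J₀ : LinIneq n}
    (hJ₀ : J₀ ∈ F) (hG : ∀ J ∈ G, J ∈ F ∨ J ∈ L) :
    ∃ M, CPValid F (L ++ (M ++ [LinIneq.falsum n])) ∧ M.length + 1 ≤ (k + 1) * (2 * n + 5) := by
  induction k generalizing L G with
  | zero =>
    cases h with
    | contradiction _ h => exact hL.exists_append_falsum_of_implied hJ₀ hG h
  | succ k ih =>
    cases h with
    | contradiction _ h =>
      obtain ⟨M, hM, hlen⟩ := hL.exists_append_falsum_of_implied hJ₀ hG h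
      exact ⟨M, hM, hlen.trans (Nat.mul_le_mul_right _ (by omega))⟩
    | cut I β h hβ hk =>
      obtain ⟨w, hw, hc, hr⟩ := h.exists_weights
      obtain ⟨M, hM, hlen⟩ := hL.exists_append_cut hJ₀ hG w hw I.coeff hc
      -- The derived line may be stronger than `I`, so the rest of the refutation is transported
      -- along `I' → I` by monotonicity.
      set I' : LinIneq n := ⟨I.coeff, ⌈∑ i, w i * ((G.get i).rhs : ℚ)⌉⟩ with hI'
      have hk' : CutRefutable (I' :: G) k := by
        refine hk.mono (fun J hJ => ?_) le_rfl
        rcases List.mem_cons.1 hJ with rfl | hJ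
        · refine (Implied.hyp (I := I') List.mem_cons_self).of_eq rfl ?_
          have : J.rhs ≤ I'.rhs := Int.le_ceil_iff.2 (by linarith)
          exact_mod_cast this
        · exact .hyp (List.mem_cons_of_mem _ hJ)
      obtain ⟨M', hM', hlen'⟩ := ih hk' hM fun J hJ => by
        rcases List.mem_cons.1 hJ with rfl | hJ
        · simp
        · exact (hG J hJ).imp id (List.mem_append_left _)
      refine ⟨M ++ [I'] ++ M', by simpa only [List.append_assoc] using hM', ?_⟩
      simp only [List.length_append, List.length_singleton]
      rw [Nat.succ_mul (k + 1)]
      omega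

end CPValid

end CPValid

/-- A refutation by `k` rounding cuts gives a Cutting Planes refutation with `O(n k)` lines. -/
theorem LinSystem.CutRefutable.exists_CPRefutation {n k : ℕ} {F : LinSystem n}
    (h : F.CutRefutable k) (hF : F ≠ []) :
    ∃ π : CPRefutation F, π.size ≤ (k + 1) * (2 * n + 5) := by
  obtain ⟨J₀, hJ₀⟩ := List.exists_mem_of_ne_nil F hF
  obtain ⟨M, hM, hlen⟩ := CPValid.exists_append_falsum h (L := [])
    (fun i hi => absurd hi (Nat.not_lt_zero i)) hJ₀ fun J hJ => Or.inl hJ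
  rw [List.nil_append] at hM
  exact ⟨⟨_, hM, by simp⟩, by simpa [CPProof.size] using hlen⟩

/-- The empty system has no refutation. -/
theorem LinSystem.CutRefutable.ne_nil {n k : ℕ} {F : LinSystem n} (h : F.CutRefutable k) :
    F ≠ [] := by
  -- The invariant is that the origin satisfies everything: a conic bound is then at most `0`, and
  -- an integer below `β + 1 ≤ 1` is at most `0` as well.
  suffices ¬ ∀ I ∈ F, I.rhs ≤ 0 by
    rintro rfl
    exact this (by simp)
  have key : ∀ {F : LinSystem n} {a : Fin n → ℚ} {β : ℚ}, F.Implied a β → (∀ I ∈ F, I.rhs ≤ 0) →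
      β ≤ 0 := by
    intro F a β h hF
    obtain ⟨w, hw, _, hr⟩ := h.exists_weights
    refine hr.trans (Finset.sum_nonpos fun i _ => mul_nonpos_of_nonneg_of_nonpos (hw i) ?_)
    exact_mod_cast hF _ (List.get_mem F i)
  intro hF
  induction h with
  | contradiction k h => exact absurd (key h hF) (by norm_num)
  | cut I β h hβ _ ih =>
    refine ih fun J hJ => ?_
    rcases List.mem_cons.1 hJ with rfl | hJ
    · have : (J.rhs : ℚ) < 1 := by linarith [key h hF]
      exact Int.lt_add_one_iff.1 (by exact_mod_cast this)
    · exact hF J hJ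

/-! ### From Cutting Planes to Stabbing Planes -/

namespace LinIneq

variable {n : ℕ}

/-- All entries of the inequality have absolute value at most `B`. -/
def EntriesLE (I : LinIneq n) (B : ℕ) : Prop := (∀ j, |I.coeff j| ≤ B) ∧ |I.rhs| ≤ B

theorem EntriesLE.mono {I : LinIneq n} {B C : ℕ} (h : I.EntriesLE B) (hBC : B ≤ C) :
    I.EntriesLE C := by
  have : (B : ℤ) ≤ C := by exact_mod_cast hBC
  exact ⟨fun j => (h.1 j).trans this, h.2.trans this⟩

theorem EntriesLE.integerNegation {I : LinIneq n} {B : ℕ} (h : I.EntriesLE B) :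
    I.integerNegation.EntriesLE (B + 1) := by
  refine ⟨fun j => ?_, ?_⟩
  · have := h.1 j
    simp only [LinIneq.integerNegation, abs_neg]
    push_cast
    omega
  · have := h.2
    simp only [LinIneq.integerNegation]
    rw [abs_le] at this ⊢
    push_cast
    omega

/-- The number `2 ^ l` has `l + 1` binary digits; the sign takes one more bit. -/
theorem _root_.intBits_le {z : ℤ} {l : ℕ} (h : |z| ≤ ((2 ^ l : ℕ) : ℤ)) : intBits z ≤ l + 2 := by
  rw [Int.abs_eq_natAbs] at h
  have : z.natAbs.size ≤ l + 1 :=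
    Nat.size_le.2 ((Nat.cast_le.1 h).trans_lt (Nat.pow_lt_pow_right one_lt_two l.lt_succ_self))
  simp only [intBits]
  omega

theorem _root_.abs_le_two_pow_intBits (z : ℤ) : |z| ≤ ((2 ^ intBits z : ℕ) : ℤ) := by
  rw [Int.abs_eq_natAbs]
  exact_mod_cast (Nat.lt_size_self z.natAbs).le.trans
    (Nat.pow_le_pow_right two_pos (Nat.le_succ _))

theorem EntriesLE.bits_le {I : LinIneq n} {l : ℕ} (h : I.EntriesLE (2 ^ l)) :
    I.bits ≤ (n + 1) * (l + 2) := by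
  have h1 : ∑ j, intBits (I.coeff j) ≤ n * (l + 2) := by
    simpa using Finset.sum_le_card_nsmul Finset.univ _ _ fun j _ => intBits_le (h.1 j)
  have h2 := intBits_le h.2
  rw [bits, Nat.succ_mul]
  omega

theorem entriesLE_two_pow_bits (I : LinIneq n) : I.EntriesLE (2 ^ I.bits) := by
  have key : ∀ {z : ℤ}, intBits z ≤ I.bits → |z| ≤ ((2 ^ I.bits : ℕ) : ℤ) := fun h =>
    (abs_le_two_pow_intBits _).trans (by exact_mod_cast Nat.pow_le_pow_right two_pos h)
  refine ⟨fun j => key ?_, key (Nat.le_add_left _ _)⟩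
  exact (Finset.single_le_sum (f := fun j => intBits (I.coeff j)) (fun _ _ => Nat.zero_le _)
    (Finset.mem_univ j)).trans (Nat.le_add_right _ _)

theorem lt_bits (I : LinIneq n) : n < I.bits := by
  have h1 : n ≤ ∑ j, intBits (I.coeff j) := by
    simpa using Finset.card_nsmul_le_sum Finset.univ (fun j => intBits (I.coeff j)) 1
      fun j _ => Nat.le_add_left 1 _
  have h2 : 1 ≤ intBits I.rhs := Nat.le_add_left 1 _
  rw [bits]
  omega

end LinIneq

namespace LinSystem

variable {n : ℕ}

theorem bits_le_of_mem {F : LinSystem n} {I : LinIneq n} (hI : I ∈ F) : I.bits ≤ F.bits :=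
  List.le_sum_of_mem (List.mem_map_of_mem hI)

theorem length_le_bits (F : LinSystem n) : F.length ≤ F.bits := by
  have := List.length_le_sum_of_one_le (F.map LinIneq.bits) fun i hi => by
    obtain ⟨I, _, rfl⟩ := List.mem_map.1 hi
    exact Nat.one_le_of_lt I.lt_bits
  simpa [bits] using this

theorem le_bits_of_ne_nil {F : LinSystem n} (hF : F ≠ []) : n ≤ F.bits := by
  obtain ⟨I, hI⟩ := List.exists_mem_of_ne_nil F hF
  exact I.lt_bits.le.trans (bits_le_of_mem hI)

theorem Implied.le_of_mem_polyhedron {F : LinSystem n} {a : Fin n → ℚ} {β : ℚ} (h : F.Implied a β)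
    {x : Fin n → ℝ} (hx : x ∈ F.polyhedron) : (β : ℝ) ≤ ∑ j, (a j : ℝ) * x j := by
  induction h with
  | hyp hI =>
    have := hx _ hI
    simpa [LinIneq.halfspace] using this
  | zero hβ => simpa using hβ
  | add _ _ h h' =>
    simp only [Pi.add_apply, Rat.cast_add, add_mul, Finset.sum_add_distrib]
    exact add_le_add h h'
  | smul ht _ h =>
    simp only [Pi.smul_apply, smul_eq_mul, Rat.cast_mul, mul_assoc, ← Finset.mul_sum]
    exact mul_le_mul_of_nonneg_left h (by exact_mod_cast ht)

theorem Implied.polyhedron_eq_empty {F : LinSystem n} (h : F.Implied 0 1) : F.polyhedron = ∅ := by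
  rw [Set.eq_empty_iff_forall_notMem]
  intro x hx
  have := h.le_of_mem_polyhedron hx
  simp at this
  linarith

/-- A bound on the bit-length of a leaf over `m` inequalities with entries at most `2 ^ l`. -/
def leafBound (n m l : ℕ) : ℕ :=
  1 + m * (2 * ((n + 1) * (n + 1) + (n + 2 + 2 * l) * (n + 1) + 2))

/-- The left side is the Cramer bound for the `n + 1` equations of a leaf; the exponent on the right
is the one in `leafBound`. -/
theorem factorial_mul_pow_le (n l : ℕ) :
    (n + 1).factorial * ((n + 1 + 1) * (2 ^ l) ^ 2) ^ (n + 1) ≤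
      2 ^ ((n + 1) * (n + 1) + (n + 2 + 2 * l) * (n + 1)) := by
  rw [pow_add 2]
  refine Nat.mul_le_mul ?_ ?_
  · refine (Nat.factorial_le_pow _).trans ?_
    rw [pow_mul]
    exact Nat.pow_le_pow_left Nat.lt_two_pow_self.le _
  · rw [pow_mul]
    refine Nat.pow_le_pow_left ?_ _
    rw [pow_add, ← pow_mul, Nat.mul_comm l]
    exact Nat.mul_le_mul_right _ Nat.lt_two_pow_self.le

/-- A system with a contradictory conic combination has one of small bit-length. -/
theorem Implied.exists_small_leaf {F : LinSystem n} (h : F.Implied 0 1) {m l : ℕ}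
    (hF : ∀ I ∈ F, I.EntriesLE (2 ^ l)) (hm : F.length ≤ m) :
    ∃ T : SPRefutation F, T.Facelike ∧ T.queries = 0 ∧ T.size ≤ leafBound n m l := by
  obtain ⟨w, hw, hc, hr⟩ := h.exists_weights
  set r := ∑ i, w i * ((F.get i).rhs : ℚ) with hrdef
  have hr0 : 0 < r := by linarith
  -- Row `some j` says that coefficient `j` cancels; row `none` normalizes the right-hand side to
  -- `1`.
  let A : Matrix (Option (Fin n)) (Fin F.length) ℤ := fun k i =>
    k.elim (F.get i).rhs (F.get i).coeff
  let e : Option (Fin n) → ℤ := fun k => k.elim 1 fun _ => 0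
  obtain ⟨u, hu, hsol, hsmall⟩ := exists_small_nonneg_solution A e (fun i => r⁻¹ * w i) (2 ^ l)
    Nat.one_le_two_pow
    (by
      rintro (_ | j) i
      · exact (hF _ (List.get_mem F i)).2
      · exact (hF _ (List.get_mem F i)).1 j)
    (by
      have : (1 : ℤ) ≤ ((2 ^ l : ℕ) : ℤ) := by exact_mod_cast Nat.one_le_two_pow
      rintro (_ | j)
      · simpa [e] using this
      · simp [e])
    (fun i => mul_nonneg (inv_nonneg.2 hr0.le) (hw i))
    (by
      rintro (_ | j)
      · simp only [A, e, Option.elim, mul_left_comm _ r⁻¹, ← Finset.mul_sum]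
        simp only [mul_comm _ (w _), ← hrdef, inv_mul_cancel₀ hr0.ne', Int.cast_one]
      · simp only [A, e, Option.elim, mul_left_comm _ r⁻¹, ← Finset.mul_sum]
        simp only [mul_comm _ (w _), hc j, Pi.zero_apply, mul_zero, Int.cast_zero])
  have hcoeff : ∀ j, ∑ i, u i * ((F.get i).coeff j : ℚ) = 0 := by
    intro j
    have := hsol (some j)
    simpa only [A, e, Option.elim, mul_comm _ (u _), Int.cast_zero] using this
  have hrhs : ∑ i, u i * ((F.get i).rhs : ℚ) = 1 := by
    have := hsol none
    simpa only [A, e, Option.elim, mul_comm _ (u _), Int.cast_one] using this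
  refine ⟨.leaf F u hu hcoeff hrhs, trivial, rfl, ?_⟩
  have hle := factorial_mul_pow_le n l
  simp only [Fintype.card_option, Fintype.card_fin] at hsmall
  set E := (n + 1) * (n + 1) + (n + 2 + 2 * l) * (n + 1) with hE
  have hbits : ∀ i ∈ Finset.univ, intBits (u i).num + intBits ((u i).den : ℤ) ≤ 2 * (E + 2) := by
    intro i _
    have h1 : intBits (u i).num ≤ E + 2 := intBits_le (by
      rw [Int.abs_eq_natAbs]
      exact_mod_cast (hsmall i).1.trans hle)
    have h2 : intBits ((u i).den : ℤ) ≤ E + 2 := intBits_le (by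
      rw [Nat.abs_cast]
      exact_mod_cast (hsmall i).2.trans hle)
    omega
  have := Finset.sum_le_card_nsmul _ _ _ hbits
  simp only [Finset.card_univ, Fintype.card_fin, smul_eq_mul] at this
  simp only [SPRefutation.size, leafBound, ← hE]
  exact Nat.add_le_add_left (this.trans (Nat.mul_le_mul_right _ hm)) 1

/-- A rounding cut can be replaced by one that uses only the fractional parts of the multipliers and
hence has small entries. -/
theorem Implied.exists_small_cut {R : LinSystem n} {c : Fin n → ℤ} {β : ℚ}
    (h : R.Implied (fun j => (c j : ℚ)) β) {M : ℕ} (hR : ∀ I ∈ R, I.EntriesLE M) :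
    ∃ I : LinIneq n, I.EntriesLE (R.length * M) ∧
      (∃ γ : ℚ, R.Implied I.ratCoeff γ ∧ (I.rhs : ℚ) < γ + 1) ∧
      Implied (I :: R) (fun j => (c j : ℚ)) ⌈β⌉ := by
  obtain ⟨w, hw, hc, hr⟩ := h.exists_weights
  set γ := ∑ i, Int.fract (w i) * ((R.get i).rhs : ℚ) with hγ
  -- Subtracting the integral parts from `c` shows that the entries are integers; writing them with
  -- the fractional weights, each below `1`, bounds them by `R.length * M`.
  let I : LinIneq n := ⟨fun j => c j - ∑ i, ⌊w i⌋ * (R.get i).coeff j, ⌈γ⌉⟩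
  have hI : ∀ j, (I.coeff j : ℚ) = ∑ i, Int.fract (w i) * ((R.get i).coeff j : ℚ) := by
    intro j
    simp only [I, Int.fract, sub_mul, Finset.sum_sub_distrib]
    rw [hc j]
    push_cast
    rfl
  have hbound : ∀ f : Fin R.length → ℤ, (∀ i, |f i| ≤ M) →
      |∑ i, Int.fract (w i) * (f i : ℚ)| ≤ ((R.length * M : ℕ) : ℚ) := by
    intro f hf
    refine (Finset.abs_sum_le_sum_abs _ _).trans ?_
    have : ∀ i ∈ Finset.univ, |Int.fract (w i) * (f i : ℚ)| ≤ (M : ℚ) := by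
      intro i _
      have h1 : |(f i : ℚ)| ≤ M := by exact_mod_cast hf i
      rw [abs_mul, abs_of_nonneg (Int.fract_nonneg _)]
      exact (mul_le_of_le_one_left (abs_nonneg _) (Int.fract_lt_one _).le).trans h1
    refine (Finset.sum_le_card_nsmul _ _ _ this).trans ?_
    simp
  refine ⟨I, ⟨fun j => ?_, ?_⟩, ⟨γ, ?_, Int.ceil_lt_add_one γ⟩, ?_⟩
  · have := hbound (fun i => (R.get i).coeff j) fun i => (hR _ (List.get_mem R i)).1 j
    rw [← hI j] at this
    exact_mod_cast this
  · have := abs_le.1 (hbound (fun i => (R.get i).rhs) fun i => (hR _ (List.get_mem R i)).2)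
    rw [← hγ] at this
    refine abs_le.2 ⟨?_, Int.ceil_le.2 (by exact_mod_cast this.2)⟩
    have h1 := this.1.trans (Int.le_ceil γ)
    exact_mod_cast h1
  · exact of_weights (fun i => Int.fract (w i)) (fun i => Int.fract_nonneg _)
      (fun j => (hI j).symm) le_rfl
  · have h1 : Implied (I :: R) (fun j => ((∑ i, ⌊w i⌋ * (R.get i).coeff j : ℤ) : ℚ))
        ((∑ i, ⌊w i⌋ * (R.get i).rhs : ℤ) : ℚ) := by
      refine mono (F := R) ?_ fun _ => List.mem_cons_of_mem _
      refine of_weights (fun i => (⌊w i⌋ : ℚ)) (fun i => ?_) (fun j => by push_cast; rfl)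
        (le_of_eq (by push_cast; rfl))
      exact_mod_cast Int.floor_nonneg.2 (hw i)
    -- Adding the integral part back restores `c`; being an integer on the right-hand side, it
    -- passes through the ceiling.
    refine ((hyp (List.mem_cons_self (a := I) (l := R))).add h1).of_eq ?_ ?_
    · ext j
      simp [I]
    · have h2 : β ≤ γ + ((∑ i, ⌊w i⌋ * (R.get i).rhs : ℤ) : ℚ) := by
        refine hr.trans (le_of_eq ?_)
        push_cast
        simp only [hγ, ← Finset.sum_add_distrib, ← add_mul, Int.fract_add_floor]
      have h3 := Int.ceil_mono h2
      rw [Int.ceil_add_intCast] at h3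
      exact_mod_cast h3

/-- The two left-hand sides cancel and leave `0 ≥ γ + 1 - I.rhs`, whose right-hand side is positive.
Hence one side of the query is empty and is closed by a leaf. -/
theorem Implied.cons_integerNegation {R : LinSystem n} {I : LinIneq n} {γ : ℚ}
    (h : R.Implied I.ratCoeff γ) (hγ : (I.rhs : ℚ) < γ + 1) :
    Implied (I.integerNegation :: R) 0 1 := by
  have h1 := (h.mono fun _ => List.mem_cons_of_mem I.integerNegation).add
    (hyp (List.mem_cons_self (a := I.integerNegation)))
  have hpos : 0 < γ + I.integerNegation.rhs := by
    simp only [LinIneq.integerNegation]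
    push_cast
    linarith
  refine (h1.smul (inv_nonneg.2 hpos.le)).of_eq ?_ (inv_mul_cancel₀ hpos.ne').ge
  rw [LinIneq.ratCoeff_integerNegation, add_neg_cancel, smul_zero]

/-- A bound on the bit-length of a node with a leaf below it. -/
def nodeBound (n m l : ℕ) : ℕ := 1 + 2 * ((n + 1) * (l + 2)) + leafBound n m l

/-- From the lines `pre` already implied by `R`, the remaining lines `rest` of a Cutting Planes
refutation give a Stabbing Planes refutation of `R`. -/
theorem exists_facelike_of_CPValid {F : LinSystem n} {m l : ℕ} (rest : List (LinIneq n)) :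
    ∀ (pre : List (LinIneq n)) (R : LinSystem n) (M : ℕ), CPValid F (pre ++ rest) →
      (pre ++ rest).getLast? = some (LinIneq.falsum n) →
      (∀ I ∈ F, I ∈ R) → (∀ J ∈ pre, R.Implied J.ratCoeff J.rhs) →
      (∀ I ∈ R, I.EntriesLE M) → R.length + rest.length < m → M * m ^ rest.length + 1 ≤ 2 ^ l →
      ∃ T : SPRefutation R, T.Facelike ∧ T.queries ≤ rest.length ∧
        T.size ≤ (rest.length + 1) * nodeBound n m l := by
  -- `R` gains at most one inequality per line, so its length stays below `m`. Each division
  -- multiplies the entry bound `M` by at most `m`, so `2 ^ l` bounds all entries; the `+ 1` covers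
  -- integer negations.
  induction rest with
  | nil =>
    intro pre R M _ hlast _ hpre hR hm hl
    rw [List.append_nil] at hlast
    have h : R.Implied 0 1 :=
      (hpre _ (List.mem_of_getLast? hlast)).of_eq (funext fun _ => by simp [LinIneq.falsum])
        (by simp [LinIneq.falsum])
    obtain ⟨T, hT, hq, hsize⟩ := h.exists_small_leaf (m := m) (l := l)
      (fun I hI => (hR I hI).mono (by simp at hl; omega)) (by simp at hm; omega)
    refine ⟨T, hT, hq.le, hsize.trans ?_⟩
    simp [nodeBound]
  | cons I rest ih =>
    intro pre R M hval hlast hF hpre hR hm hl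
    have hstep : CPStep F pre I := by
      have := hval pre.length (by simp)
      simpa using this
    have hassoc : pre ++ I :: rest = (pre ++ [I]) ++ rest := by simp
    rw [hassoc] at hval hlast
    rw [List.length_cons] at hm hl
    have hm1 : 1 ≤ m := by omega
    have hpow : M * m ^ rest.length ≤ M * m ^ (rest.length + 1) :=
      Nat.mul_le_mul_left _ (Nat.pow_le_pow_right hm1 (Nat.le_succ _))
    -- Hypotheses and linear combinations are already conic consequences of `R` and need no query.
    have skip (hI : R.Implied I.ratCoeff I.rhs) :
        ∃ T : SPRefutation R, T.Facelike ∧ T.queries ≤ (I :: rest).length ∧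
        T.size ≤ ((I :: rest).length + 1) * nodeBound n m l := by
      obtain ⟨T, hT, hq, hsize⟩ := ih (pre ++ [I]) R M hval hlast hF
        (fun J hJ => by
          rcases List.mem_append.1 hJ with hJ | hJ
          · exact hpre J hJ
          · rwa [List.mem_singleton.1 hJ]) hR (by omega) (by omega)
      exact ⟨T, hT, hq.trans (Nat.le_succ _), hsize.trans (Nat.mul_le_mul_right _ (Nat.le_succ _))⟩
    cases hstep with
    | hyp _ hI => exact skip (.hyp (hF I hI))
    | linComb J K hJ hK α β =>
      refine skip ((((hpre J hJ).smul α.cast_nonneg).add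
        ((hpre K hK).smul β.cast_nonneg)).of_eq ?_ (le_of_eq ?_))
      · ext j
        simp [LinIneq.linComb]
      · simp [LinIneq.linComb]
    | division J hJ d hd hdvd =>
      have hdQ : (0 : ℚ) < d := by exact_mod_cast hd
      have hdiv : R.Implied (fun j => ((J.divide d).coeff j : ℚ)) (J.rhs / d) := by
        refine ((hpre J hJ).smul (inv_nonneg.2 hdQ.le)).of_eq ?_ (le_of_eq ?_)
        · ext j
          obtain ⟨c, hc⟩ := hdvd j
          have hd0 : (d : ℤ) ≠ 0 := by exact_mod_cast hd.ne'
          simp only [LinIneq.divide, Pi.smul_apply, LinIneq.ratCoeff_apply, hc, smul_eq_mul,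
            Int.mul_ediv_cancel_left _ hd0]
          push_cast
          field_simp
        · rw [div_eq_inv_mul]
      obtain ⟨I, hI, ⟨γ, hγ, hlt⟩, himp⟩ := hdiv.exists_small_cut hR
      have hIm : I.EntriesLE (M * m) := hI.mono (by
        rw [Nat.mul_comm]
        exact Nat.mul_le_mul_left _ (by omega))
      have hMm : M ≤ M * m := Nat.le_mul_of_pos_right M hm1
      have hmul : M * m ≤ M * m ^ (rest.length + 1) :=
        Nat.mul_le_mul_left _ (Nat.le_self_pow (by omega) m)
      have hfalse := hγ.cons_integerNegation hlt
      obtain ⟨T₁, hT₁, hq₁, hsize₁⟩ := hfalse.exists_small_leaf (m := m) (l := l)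
        (fun K hK => by
          rcases List.mem_cons.1 hK with rfl | hK
          · exact hIm.integerNegation.mono (by omega)
          · exact (hR K hK).mono (by omega)) (by simp; omega)
      obtain ⟨T₂, hT₂, hq₂, hsize₂⟩ := ih (pre ++ [J.divide d]) (I :: R) (M * m) hval hlast
        (fun K hK => List.mem_cons_of_mem _ (hF K hK))
        (fun K hK => by
          rcases List.mem_append.1 hK with hK | hK
          · exact (hpre K hK).mono fun _ => List.mem_cons_of_mem _
          · rw [List.mem_singleton.1 hK]
            exact himp)
        (fun K hK => by
          rcases List.mem_cons.1 hK with rfl | hK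
          · exact hIm
          · exact (hR K hK).mono hMm)
        (by simp; omega) (by rw [Nat.mul_assoc, ← Nat.pow_succ']; exact hl)
      refine ⟨.node R I T₁ T₂, ⟨Or.inl (Or.inl ?_), hT₁, hT₂⟩, ?_, ?_⟩
      · rw [← hfalse.polyhedron_eq_empty]
        ext x
        simp [polyhedron, and_comm]
      · simp only [SPRefutation.queries, List.length_cons]
        omega
      · have hb : I.bits ≤ (n + 1) * (l + 2) := (hIm.mono (by omega)).bits_le
        have hb' : I.integerNegation.bits ≤ (n + 1) * (l + 2) :=
          (hIm.integerNegation.mono (by omega)).bits_le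
        simp only [SPRefutation.size, List.length_cons]
        rw [Nat.succ_mul (rest.length + 1), nodeBound] at *
        omega

end LinSystem

/-! ### Polynomial bounds and the final assembly -/

open LinSystem

/-- A Cutting Planes refutation gives a facelike Stabbing Planes refutation that is small both in
the number of its queries and in its bit-length. -/
theorem CPProof.exists_facelike {n : ℕ} {F : LinSystem n} (π : CPRefutation F) :
    ∃ T : SPRefutation F, T.Facelike ∧ T.queries ≤ π.size ∧
      T.size ≤ (π.size + 1) * nodeBound n (F.bits + π.size + 1)
        (F.bits + (F.bits + π.size + 1) * π.size + 1) := by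
  refine exists_facelike_of_CPValid (F := F) π.lines [] F (2 ^ F.bits) π.valid π.ends
    (fun _ => id) (by simp) (fun I hI => I.entriesLE_two_pow_bits.mono
      (Nat.pow_le_pow_right two_pos (bits_le_of_mem hI))) ?_ ?_
  · have := F.length_le_bits
    simp only [CPProof.size]
    omega
  · simp only [CPProof.size]
    set m := F.bits + π.lines.length + 1
    -- From `m ≤ 2 ^ m`, the entry bound is at most `2 ^ (F.bits + m * s)` with `s` the number of
    -- lines; the last `+ 1` in the exponent absorbs the additive `1`.
    have h1 : m ^ π.lines.length ≤ 2 ^ (m * π.lines.length) := by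
      rw [pow_mul]
      exact Nat.pow_le_pow_left Nat.lt_two_pow_self.le _
    have h2 : 1 ≤ 2 ^ (F.bits + m * π.lines.length) := Nat.one_le_two_pow
    rw [Nat.pow_succ]
    have h3 := Nat.mul_le_mul_left (2 ^ F.bits) h1
    rw [← pow_add] at h3
    omega

theorem SPRefutation.queries_le_size {n : ℕ} {F : LinSystem n} (T : SPRefutation F) :
    T.queries ≤ T.size := by
  induction T with
  | leaf => exact Nat.zero_le _
  | node F q l r ihl ihr =>
    simp only [queries, size]
    omega

theorem nodeBound_mono {n n' m m' l l' : ℕ} (hn : n ≤ n') (hm : m ≤ m') (hl : l ≤ l') :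
    nodeBound n m l ≤ nodeBound n' m' l' := by
  unfold nodeBound leafBound
  gcongr

theorem SPRefutation.exists_CPRefutation {n : ℕ} {F : LinSystem n} (T : SPRefutation F)
    (hT : T.Facelike) : ∃ π : CPRefutation F, π.size ≤ (T.queries + 1) * (2 * n + 5) :=
  (CutRefutable.of_facelike T hT).exists_CPRefutation (CutRefutable.of_facelike T hT).ne_nil

theorem polySimulates_CP_facelikeSPQueries :
    PolySimulates (fun n _ => n) CPSystem FacelikeSPQueries := by
  refine ⟨(Polynomial.X + 1) * (2 * Polynomial.X + 5), ?_⟩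
  rintro n F s ⟨T, hT, rfl⟩
  obtain ⟨π, hπ⟩ := T.exists_CPRefutation hT
  refine ⟨π.size, hπ.trans ?_, π, rfl⟩
  simp only [Polynomial.eval_mul, Polynomial.eval_add, Polynomial.eval_X, Polynomial.eval_one,
    Polynomial.eval_ofNat]
  gcongr <;> omega

theorem polySimulates_CP_facelikeSP : PolySimulates (fun _ F => F.bits) CPSystem FacelikeSP := by
  refine ⟨(Polynomial.X + 1) * (2 * Polynomial.X + 5), ?_⟩
  rintro n F s ⟨T, hT, rfl⟩
  obtain ⟨π, hπ⟩ := T.exists_CPRefutation hT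
  refine ⟨π.size, hπ.trans ?_, π, rfl⟩
  -- The bit-length bounds the dimension only for a non-empty system, and a refutable system is
  -- non-empty.
  have hn := le_bits_of_ne_nil (CutRefutable.of_facelike T hT).ne_nil
  have hq := T.queries_le_size
  simp only [Polynomial.eval_mul, Polynomial.eval_add, Polynomial.eval_X, Polynomial.eval_one,
    Polynomial.eval_ofNat]
  gcongr <;> omega

theorem polySimulates_facelikeSPQueries_CP :
    PolySimulates (fun n _ => n) FacelikeSPQueries CPSystem := by
  refine ⟨Polynomial.X, ?_⟩
  rintro n F s ⟨π, rfl⟩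
  obtain ⟨T, hT, hq, _⟩ := π.exists_facelike
  refine ⟨T.queries, ?_, T, hT, rfl⟩
  rw [Polynomial.eval_X]
  omega

-- Here `x` stands for `F.bits + s`, which dominates `n`, `F.bits` and `s`; monotonicity of
-- `nodeBound` then allows a polynomial in one variable.
open Polynomial in
theorem exists_polynomial_nodeBound :
    ∃ p : ℕ[X], ∀ x : ℕ, p.eval x = (x + 1) * nodeBound x (x + 1) (x + (x + 1) * x + 1) := by
  refine ⟨(X + 1) * (1 + 2 * ((X + 1) * ((X + (X + 1) * X + 1) + 2)) + (1 + (X + 1) * (2 *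
    ((X + 1) * (X + 1) + (X + 2 + 2 * (X + (X + 1) * X + 1)) * (X + 1) + 2)))), fun x => ?_⟩
  simp [nodeBound, leafBound]

theorem polySimulates_facelikeSP_CP : PolySimulates (fun _ F => F.bits) FacelikeSP CPSystem := by
  obtain ⟨p, hp⟩ := exists_polynomial_nodeBound
  refine ⟨p, ?_⟩
  rintro n F s ⟨π, rfl⟩
  obtain ⟨T, hT, _, hsize⟩ := π.exists_facelike
  refine ⟨T.size, hsize.trans ?_, T, hT, rfl⟩
  have hn := le_bits_of_ne_nil (CutRefutable.of_facelike T hT).ne_nil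
  rw [hp]
  beta_reduce
  refine Nat.mul_le_mul (by omega) (nodeBound_mono (by omega) le_rfl ?_)
  gcongr <;> omega

theorem theorem1 :
    PolyEquivalent (fun _ F => F.bits) CPSystem FacelikeSP ∧
      PolyEquivalent (fun n _ => n) CPSystem FacelikeSPQueries :=
  ⟨⟨polySimulates_CP_facelikeSP, polySimulates_facelikeSP_CP⟩,
    polySimulates_CP_facelikeSPQueries, polySimulates_facelikeSPQueries_CP⟩
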